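/- **Conventions.** A transition system graph $(V,E,\mathrm{Source},\mathrm{Target},I_0)$ is a directed (multi)graph with a finite set $E$ of edges, a non-empty set $I_0\subseteq V$ of initial vertices, and at least one outgoing edge at every vertex. A transition system adds a colouring $\gamma:E\to\Gamma$ and an acceptance condition $\mathrm{Acc}\subseteq\Gamma^\omega$; an infinite run $\varrho$ (an infinite path) is accepting if $\gamma(\varrho)\in\mathrm{Acc}$. $\mathrm{Inf}(w)$ is the set of letters occurring infinitely often in $w$. A Muller condition $\mathcal F\subseteq\mathcal P(\Gamma)$ accepts $w$ iff $\mathrm{Inf}(w)\in\mathcal F$. A parity condition (finitely many colours in $\mathbb N$) accepts $w$ iff $\min\mathrm{Inf}(w)$ is even. A morphism $\varphi=(\varphi_V,\varphi_E):\mathcal T\to\mathcal T'$ preserves initial vertices, sources, targets, and acceptance of every infinite run from an initial vertex ($\varrho$ is accepting iff $\varphi_E(\varrho)$ is); it is locally bijective if it restricts to bijections $I_0\to I_0'$ and $\mathrm{Out}(v)\to\mathrm{Out}(\varphi_V(v))$ for every $v\in V$. A morphism of labelled transition systems preserves in addition the labels of vertices and edges. **Alternating cycle decomposition.** Let $\mathcal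 T$ be a Muller transition system; replacing a Muller condition $\mathcal F$ on colours by $\{A\subseteq E:\gamma(A)\in\mathcal F\}$, regard the condition as a family $\mathcal F\subseteq\mathcal P(E)$. A loop is the set of edges of a non-empty closed finite path; $\mathrm{States}(l)$ is the set of sources of the edges of $l$. For every maximal loop $l_i$ ($1\le i\le r$) there is a finite ordered tree $t_i$ with nodes labelled by loops, $\nu_i$ being the labelling: the root is labelled by $l_i$, and the children of a node $\tau$ are labelled, bijectively and in an arbitrary fixed order, by the maximal loops in $\{l\subseteq\nu_i(\tau): l\text{ a loop},\ l\in\mathcal F\Leftrightarrow\nu_i(\tau)\notin\mathcal F\}$. The tree $t_0$ is a single node labelled by $E\setminus\bigcup_i l_i$, with $\mathrm{States}=V\setminus\bigcup_i\mathrm{States}(l_i)$. The index of $q\in V$ is the unique $i$ such that $q$ is a state of the root of $t_i$, and $t_q$ is the subtree of the nodes of $t_i$ that have $q$ among their states. Depth is counted from $0$ at the root. The decomposition is odd if all trees of maximal height among $t_1,\dots,t_r$ have a root label $\notin\mathcal F$. The priority $p_i(\tau)$, $i\ge1$, is $\mathrm{depth}(\tau)+1$ if $l_i\notin\mathcal F$;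 if $l_i\in\mathcal F$ it is $\mathrm{depth}(\tau)+2$ if the decomposition is odd, and $\mathrm{depth}(\tau)$ otherwise. The priority of the node of $t_0$ is $1$ if the decomposition is odd and $0$ otherwise. **Transformation.** $\mathcal P_{\mathcal{ACD}(\mathcal T)}$ is the following system. Its vertices are the triples $(q,i,\beta)$ with $q\in V$ of index $i$ and $\beta$ a branch of $t_q$. Its initial vertices are those with $q\in I_0$ and $\beta$ the leftmost branch of $t_q$. Its edges are the $e_{i,\beta}$, one for each vertex $(q,i,\beta)$ and each $e\in\mathrm{Out}(q)$, with source $(q,i,\beta)$. Let $q'=\mathrm{Target}(e)$ have index $j$. If $i=j$, let $\tau$ be the deepest node of $\beta$ with $e\in\nu_i(\tau)$, and define the node $\tau'$ of $t_{q'}$ thus: $\tau'=\tau$ if $\tau$ is a leaf of $t_{q'}$; otherwise $\tau'$ is the first child of $\tau$ in $t_{q'}$ strictly to the right of the child of $\tau$ lying on $\beta$, if the latter and such a child exist; otherwise $\tau'$ is the first child of $\tau$ in $t_{q'}$. If $i\ne j$, let $\tau=\tau'$ be the root of $t_j$. The target of $e_{i,\beta}$ is $(q',j,\beta')$ with $\beta'$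 the leftmost branch of $t_{q'}$ through $\tau'$, and its priority is $p_j(\tau)$. If $\mathcal T$ is labelled, $(q,i,\beta)$ and $e_{i,\beta}$ receive the labels of $q$ and $e$. **Proposition (correctness of the ACD-transformation).** Let $\mathcal T$ be a Muller transition system and fix any order of the siblings in its alternating cycle decomposition. Then $\mathcal P=\mathcal P_{\mathcal{ACD}(\mathcal T)}$ is a finite parity transition system, and the projection $\varphi=(\varphi_V,\varphi_E)$, $\varphi_V(q,i,\beta)=q$, $\varphi_E(e_{i,\beta})=e$, is a locally bijective morphism $\mathcal P\to\mathcal T$. It induces bijections between the finite, and between the infinite, runs of $\mathcal P$ and of $\mathcal T$ from initial vertices, and preserves acceptance of the infinite ones. If $\mathcal T$ is labelled, $\varphi$ is a morphism of labelled transition systems. Moreover: 1. If $\mathcal T$ is an automaton (its edges are labelled by input letters), then $\mathcal P$ accepts the same language, and $\mathcal T$ is deterministic (resp. unambiguous, good for games) if and only if $\mathcal P$ is. Here deterministic means that there is exactly one initial state and, for every state and letter, exactly one outgoing edge with this letter; unambiguous means that there is at most one accepting run over each word; good for games means that there are an initial state $q_0$ and a map $\sigma$ from finite words to edges such that, for every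 word $u_0u_1\cdots$ of the language, $\sigma(u_0)\,\sigma(u_0u_1)\,\sigma(u_0u_1u_2)\cdots$ is an accepting run over it from $q_0$. 2. If $\mathcal T$ is a game (a single initial vertex, each vertex being owned by Eve or Adam; Eve wins the accepting infinite plays and Adam the others), then $\mathcal P$ is a game, each player wins $\mathcal T$ if and only if she or he wins $\mathcal P$, and the winning regions satisfy $\mathcal W_P(\mathcal T)=\varphi_V(\mathcal W_P(\mathcal P))$ for both players $P$. -/

import Mathlib

/-! ### Transition systems, runs, acceptance -/

/-- A directed graph with a nonempty set of initial vertices in which every vertex has at least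
one outgoing edge. -/
structure TSGraph (V E : Type*) where
  source : E → V
  target : E → V
  init : Set V
  init_nonempty : init.Nonempty
  out_nonempty : ∀ v, ∃ e, source e = v

/-- A transition system: a transition system graph with a colouring of the edges and an
acceptance condition, which is a set of infinite words of colours. -/
structure TransitionSystem (V E C : Type*) extends TSGraph V E where
  color : E → C
  acc : Set (ℕ → C)

/-- The letters that occur infinitely often in an infinite word. -/
def infSet {A : Type*} (w : ℕ → A) : Set A := {a | {n | w n = a}.Infinite}

/-- The Muller condition given by a family `F` of sets of colours. -/
def mullerAcc {C : Type*} (F : Set (Set C)) : Set (ℕ → C) := {w | infSet w ∈ F}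

/-- The (min-)parity condition: the least priority that occurs infinitely often is even. -/
def parityAcc : Set (ℕ → ℕ) := {w | ∃ m, IsLeast (infSet w) m ∧ Even m}

namespace TSGraph

variable {V E : Type*} (G : TSGraph V E)

/-- The finite sequence of edges `ρ` (possibly empty) is a finite run from the vertex `v`. -/
def IsFinRunFrom : V → List E → Prop
  | _, [] => True
  | v, e :: ρ => G.source e = v ∧ IsFinRunFrom (G.target e) ρ

/-- The vertex in which the finite run `ρ` from `v` ends. -/
def endpoint : V → List E → V
  | v, [] => v
  | _, e :: ρ => endpoint (G.target e) ρ

/-- The sequence of edges `ρ` is an infinite run from the vertex `v`. -/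
def IsInfRunFrom (v : V) (ρ : ℕ → E) : Prop :=
  G.source (ρ 0) = v ∧ ∀ n, G.target (ρ n) = G.source (ρ (n + 1))

/-- The finite runs from an initial vertex. -/
def finRuns : Set (List E) := {ρ | ∃ v ∈ G.init, G.IsFinRunFrom v ρ}

/-- The infinite runs from an initial vertex. -/
def infRuns : Set (ℕ → E) := {ρ | ∃ v ∈ G.init, G.IsInfRunFrom v ρ}

end TSGraph

namespace TransitionSystem

variable {V E C : Type*} (T : TransitionSystem V E C)

/-- The infinite run `ρ` is accepting. -/
def Accepts (ρ : ℕ → E) : Prop := (fun n => T.color (ρ n)) ∈ T.acc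

/-- `T` is a Muller transition system, with Muller condition given by the family `F`. -/
def IsMuller (F : Set (Set C)) : Prop := T.acc = mullerAcc F

/-- `T` is a parity transition system: finitely many priorities, with the parity condition. -/
def IsParity (T : TransitionSystem V E ℕ) : Prop :=
  (Set.range T.color).Finite ∧ T.acc = parityAcc

end TransitionSystem

/-! ### Morphisms -/

section Morphisms

variable {V E C V' E' C' : Type*}

/-- `(fV, fE)` is a morphism of transition systems from `T` to `T'`. -/
structure IsTSMorphism (T : TransitionSystem V E C) (T' : TransitionSystem V' E' C')
    (fV : V → V') (fE : E → E') : Prop where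
  map_init : ∀ v ∈ T.init, fV v ∈ T'.init
  map_source : ∀ e, T'.source (fE e) = fV (T.source e)
  map_target : ∀ e, T'.target (fE e) = fV (T.target e)
  map_acc : ∀ ρ ∈ T.infRuns, (T.Accepts ρ ↔ T'.Accepts (fun n => fE (ρ n)))

/-- `(fV, fE)` is a locally surjective morphism. -/
structure IsTSLocallySurjective (T : TransitionSystem V E C) (T' : TransitionSystem V' E' C')
    (fV : V → V') (fE : E → E') : Prop extends IsTSMorphism T T' fV fE where
  surj_init : ∀ v' ∈ T'.init, ∃ v ∈ T.init, fV v = v'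
  surj_out : ∀ v e', T'.source e' = fV v → ∃ e, fE e = e' ∧ T.source e = v

/-- `(fV, fE)` is a locally injective morphism. -/
structure IsTSLocallyInjective (T : TransitionSystem V E C) (T' : TransitionSystem V' E' C')
    (fV : V → V') (fE : E → E') : Prop extends IsTSMorphism T T' fV fE where
  inj_init : ∀ v₁ ∈ T.init, ∀ v₂ ∈ T.init, fV v₁ = fV v₂ → v₁ = v₂
  inj_out : ∀ e₁ e₂, T.source e₁ = T.source e₂ → fE e₁ = fE e₂ → e₁ = e₂

/-- `(fV, fE)` is a locally bijective morphism. -/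
def IsTSLocallyBijective (T : TransitionSystem V E C) (T' : TransitionSystem V' E' C')
    (fV : V → V') (fE : E → E') : Prop :=
  IsTSLocallySurjective T T' fV fE ∧ IsTSLocallyInjective T T' fV fE

/-- `(fV, fE)` is a morphism of labelled transition systems, from `T` with labels `lV`, `lE` of
vertices and edges to `T'` with labels `lV'`, `lE'`. -/
def IsLabelledMorphism {LV LE : Type*}
    (T : TransitionSystem V E C) (lV : V → LV) (lE : E → LE)
    (T' : TransitionSystem V' E' C') (lV' : V' → LV) (lE' : E' → LE)
    (fV : V → V') (fE : E → E') : Prop :=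
  IsTSMorphism T T' fV fE ∧ (∀ v, lV' (fV v) = lV v) ∧ (∀ e, lE' (fE e) = lE e)

end Morphisms

/-! ### Automata: transition systems whose edges are labelled by input letters -/

namespace TransitionSystem

variable {V E C A : Type*} (T : TransitionSystem V E C) (letter : E → A)

/-- `ρ` is a run of the automaton over the infinite word `u`. -/
def IsRunOver (u : ℕ → A) (ρ : ℕ → E) : Prop := ρ ∈ T.infRuns ∧ ∀ n, letter (ρ n) = u n

/-- The language accepted by the automaton. -/
def language : Set (ℕ → A) := {u | ∃ ρ, T.IsRunOver letter u ρ ∧ T.Accepts ρ}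

/-- There is one initial state and exactly one transition for each state and each letter. -/
def IsDeterministic : Prop :=
  (∃ v₀, T.init = {v₀}) ∧ ∀ v a, ∃! e, T.source e = v ∧ letter e = a

/-- Every infinite word has at most one accepting run over it. -/
def IsUnambiguous : Prop :=
  ∀ u ρ₁ ρ₂, T.IsRunOver letter u ρ₁ → T.Accepts ρ₁ → T.IsRunOver letter u ρ₂ → T.Accepts ρ₂ →
    ρ₁ = ρ₂

/-- The automaton is good for games: there are an initial state `q₀` and a resolver `σ`, which
selects the transition for the last letter of each nonempty finite word, such that for every
word `u` of the language the transitions selected along the prefixes of `u` form an accepting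
run over `u` from `q₀`. -/
def IsGoodForGames : Prop :=
  ∃ q₀ ∈ T.init, ∃ σ : List A → E, ∀ u ∈ T.language letter,
    let ρ : ℕ → E := fun n => σ ((List.range (n + 1)).map u)
    T.IsInfRunFrom q₀ ρ ∧ (∀ n, letter (ρ n) = u n) ∧ T.Accepts ρ

end TransitionSystem

/-! ### Games: transition systems whose vertices are labelled by players -/

inductive Player
  | Eve
  | Adam

namespace TransitionSystem

variable {V E C : Type*} (T : TransitionSystem V E C) (owner : V → Player)

/-- `S` is a strategy of the player `P` in the game with initial vertex `v₀`: after each finite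
play that ends in a vertex of `P` it selects an edge that leaves this vertex. -/
def IsStrategy (v₀ : V) (P : Player) (S : List E → E) : Prop :=
  ∀ ρ, T.IsFinRunFrom v₀ ρ → owner (T.endpoint v₀ ρ) = P →
    T.source (S ρ) = T.endpoint v₀ ρ

/-- The infinite play `ρ` is consistent with the strategy `S` of the player `P`. -/
def Consistent (P : Player) (S : List E → E) (ρ : ℕ → E) : Prop :=
  ∀ n, owner (T.source (ρ n)) = P → ρ n = S ((List.range n).map ρ)

/-- The player wins the infinite play `ρ`. -/
def WinsPlay (ρ : ℕ → E) : Player → Prop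
  | Player.Eve => T.Accepts ρ
  | Player.Adam => ¬ T.Accepts ρ

/-- The player `P` wins the game with initial vertex `v₀`. -/
def WinsFrom (v₀ : V) (P : Player) : Prop :=
  ∃ S, T.IsStrategy owner v₀ P S ∧
    ∀ ρ, T.IsInfRunFrom v₀ ρ → T.Consistent owner P S ρ → T.WinsPlay ρ P

/-- The winning region of the player `P`. -/
def winningRegion (P : Player) : Set V := {v | T.WinsFrom owner v P}

end TransitionSystem

/-! ### Trees

Nodes are finite sequences of natural numbers, `[]` is the root, the ancestor relation is the
prefix relation `<+:`, and siblings are ordered by their last entry. A branch is the set of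
prefixes of a leaf; it is represented by this leaf `β`, so that "`τ` lies on `β`" is `τ <+: β`. -/

/-- `σ` is a leaf of the tree `t`. -/
def IsLeaf (t : Set (List ℕ)) (σ : List ℕ) : Prop := σ ∈ t ∧ ∀ τ ∈ t, σ <+: τ → τ = σ

/-- `β` is the leftmost branch of `t` among those through the node `τ` (smallest leaf in the
lexicographic order). -/
def IsLeftmost (t : Set (List ℕ)) (τ β : List ℕ) : Prop :=
  (IsLeaf t β ∧ τ <+: β) ∧ ∀ β', IsLeaf t β' → τ <+: β' → β ≤ β'

/-- The height of a tree: maximal depth of a leaf, plus one. -/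
noncomputable def treeHeight (t : Set (List ℕ)) : ℕ := sSup {n | ∃ σ, IsLeaf t σ ∧ n = σ.length} + 1

open Classical in
/-- The leftmost branch of `t` through `τ`. -/
noncomputable def leftmost (t : Set (List ℕ)) (τ : List ℕ) : List ℕ :=
  if h : ∃ β, IsLeftmost t τ β then h.choose else τ

/-- The order in which the children of the nodes are introduced: for each node `τ` and each set
`X` of labels, an enumeration of `X` without repetitions. -/
structure SiblingOrder (E : Type*) where
  enum : List ℕ → Set (Set E) → List (Set E)
  nodup : ∀ τ X, (enum τ X).Nodup
  mem_enum : ∀ τ X l, l ∈ enum τ X ↔ l ∈ X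

theorem SiblingOrder.nonempty (E : Type*) [Finite E] : Nonempty (SiblingOrder E) :=
  ⟨{ enum := fun _ X => (Set.toFinite X).toFinset.toList
     nodup := fun _ _ => Finset.nodup_toList _
     mem_enum := by simp }⟩

/-! ### The alternating cycle decomposition -/

namespace TSGraph

variable {V E : Type*} (G : TSGraph V E)

/-- `l` is a loop: the set of edges that appear in some nonempty closed finite run. -/
def IsLoop (l : Set E) : Prop :=
  ∃ v ρ, ρ ≠ [] ∧ G.IsFinRunFrom v ρ ∧ G.endpoint v ρ = v ∧ {e | e ∈ ρ} = l

/-- `l` is a maximal loop, for inclusion. -/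
def IsMaxLoop (l : Set E) : Prop := Maximal G.IsLoop l

/-- The states of a loop. -/
def loopStates (l : Set E) : Set V := {v | ∃ e ∈ l, G.source e = v}

/-- The labels of the children of a node with label `S`: the maximal sets among the loops `l`
contained in `S` such that `l ∈ F` if and only if `S ∉ F`. -/
def childLoops (F : Set (Set E)) (S : Set E) : Set (Set E) :=
  {l | Maximal (fun l => l ⊆ S ∧ G.IsLoop l ∧ (l ∈ F ↔ S ∉ F)) l}

variable (F : Set (Set E)) (ord : SiblingOrder E)

/-- The label reached by going down along `τ` from a node at position `pre` with label `S`;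
`none` if one leaves the tree. -/
def labelFrom : List ℕ → Set E → List ℕ → Option (Set E)
  | _, S, [] => some S
  | pre, S, k :: τ =>
    ((ord.enum pre (G.childLoops F S))[k]?).bind fun S' => labelFrom (pre ++ [k]) S' τ

/-- The label of the node `τ` of the tree of index `i` of the alternating cycle decomposition,
`none` if there is no such node. The trees of index `1, ..., r` are the proper trees, whose roots
are labelled by the maximal loops. The tree of index `0` has a single node, labelled by the edges
that belong to no loop. -/
def acdLabel : ℕ → List ℕ → Option (Set E)
  | 0, [] => some {e | ∀ l, G.IsMaxLoop l → e ∉ l}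
  | 0, _ :: _ => none
  | i + 1, τ => ((ord.enum [] {l | G.IsMaxLoop l})[i]?).bind fun l => G.labelFrom F ord [i] l τ

/-- The set of nodes of the tree of index `i`. -/
def acdTree (i : ℕ) : Set (List ℕ) := {τ | (G.acdLabel F ord i τ).isSome}

/-- The label of the node `τ` in the tree of index `i` (used for nodes only). -/
def acdNu (i : ℕ) (τ : List ℕ) : Set E := (G.acdLabel F ord i τ).getD ∅

/-- The states of a node. For the root of the tree of index `0` these are the states that belong
to no loop. -/
def nodeStates : ℕ → List ℕ → Set V
  | 0, _ => {v | ∀ l, G.IsMaxLoop l → v ∉ G.loopStates l}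
  | i + 1, τ => G.loopStates (G.acdNu F ord (i + 1) τ)

/-- The index of a state: the (only) number `i` such that the state belongs to the root of the
tree of index `i`. -/
noncomputable def stateIndex (q : V) : ℕ := sInf {i | q ∈ G.nodeStates F ord i []}

/-- The subtree associated to the state `q`. -/
def stateTree (q : V) : Set (List ℕ) :=
  {τ | τ ∈ G.acdTree F ord (G.stateIndex F ord q) ∧
    q ∈ G.nodeStates F ord (G.stateIndex F ord q) τ}

/-- The index `i` is that of a proper tree. -/
def IsProper (i : ℕ) : Prop := 1 ≤ i ∧ [] ∈ G.acdTree F ord i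

/-- All proper trees of maximal height have a root label outside `F`. (Otherwise the
decomposition is even or ambiguous.) -/
def IsOddACD : Prop :=
  ∀ i, G.IsProper F ord i →
    (∀ j, G.IsProper F ord j →
      treeHeight (G.acdTree F ord j) ≤ treeHeight (G.acdTree F ord i)) →
    G.acdNu F ord i [] ∉ F

open Classical in
/-- The priority of the node `τ` of the tree of index `i`. -/
noncomputable def nodePriority (i : ℕ) (τ : List ℕ) : ℕ :=
  if i = 0 then (if G.IsOddACD F ord then 1 else 0)
  else if G.acdNu F ord i [] ∈ F then
    (if G.IsOddACD F ord then τ.length + 2 else τ.length)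
  else τ.length + 1

open Classical in
/-- The support of the edge `e` from the branch `β` of (a subtree of) the tree of index `i`: if
the target of `e` has index `i`, the deepest node of `β` whose label contains `e`, and otherwise
the root (of the tree of the target). -/
noncomputable def supp (β : List ℕ) (i : ℕ) (e : E) : List ℕ :=
  if i = G.stateIndex F ord (G.target e) then
    β.take (Nat.findGreatest (fun n => e ∈ G.acdNu F ord i (β.take n)) β.length)
  else []

open Classical in
/-- The next child of the node `τ` of the branch `β`, in the tree `t_q`: `τ` itself if it is a
leaf of `t_q`; else the first child of `τ` in `t_q` strictly to the right of the child of `τ` on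
`β`, if this child on `β` and some such child of `τ` in `t_q` exist; else the first child of `τ`
in `t_q`. -/
noncomputable def nextChild (q : V) (β τ : List ℕ) : List ℕ :=
  if IsLeaf (G.stateTree F ord q) τ then τ
  else if ∃ m, β[τ.length]? = some m ∧ ∃ k, m < k ∧ τ ++ [k] ∈ G.stateTree F ord q then
    τ ++ [sInf {k | (∃ m, β[τ.length]? = some m ∧ m < k) ∧ τ ++ [k] ∈ G.stateTree F ord q}]
  else τ ++ [sInf {k | τ ++ [k] ∈ G.stateTree F ord q}]

open Classical in
/-- The next branch, in the tree `t_q`, after the branch `β` of (a subtree of) the tree of index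
`i` and the node `τ`. -/
noncomputable def nextBranch (q : V) (β : List ℕ) (i : ℕ) (τ : List ℕ) : List ℕ :=
  if i = G.stateIndex F ord q then
    leftmost (G.stateTree F ord q) (G.nextChild F ord q β τ)
  else leftmost (G.stateTree F ord q) τ

/-- The states `(q, i, β)` of the transformed system: `q` is a state of index `i` and `β` is a
branch of `t_q`. -/
@[ext]
structure ACDState where
  state : V
  index : ℕ
  branch : List ℕ
  index_eq : index = G.stateIndex F ord state
  isLeaf : IsLeaf (G.stateTree F ord state) branch

/-- The edges `e_{i,β}` of the transformed system: an edge `e` together with a state `(q, i, β)`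
such that `e` leaves `q`. -/
@[ext]
structure ACDEdge where
  edge : E
  origin : G.ACDState F ord
  source_eq : G.source edge = origin.state

/-! Facts which show that the transformed system is well defined. -/

theorem target_mem_loopStates {l : Set E} (hl : G.IsLoop l) {e : E} (he : e ∈ l) :
    G.target e ∈ G.loopStates l := by
  obtain ⟨v, ρ, hne, hrun, hend, rfl⟩ := hl
  have key : ∀ (ρ : List E) (v : V), G.IsFinRunFrom v ρ → ∀ e ∈ ρ,
      (∃ e' ∈ ρ, G.source e' = G.target e) ∨ G.target e = G.endpoint v ρ := by
    intro ρ
    induction ρ with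
    | nil => intro v _ e he; simp at he
    | cons a ρ ih =>
      intro v hr e he
      rcases List.mem_cons.1 he with rfl | he
      · cases ρ with
        | nil => right; simp [endpoint]
        | cons b ρ => left; exact ⟨b, by simp, hr.2.1⟩
      · rcases ih _ hr.2 e he with ⟨e', h1, h2⟩ | h
        · exact Or.inl ⟨e', List.mem_cons_of_mem _ h1, h2⟩
        · right; simpa [endpoint] using h
  rcases key ρ v hrun e he with ⟨e', h1, h2⟩ | h
  · exact ⟨e', h1, h2⟩
  · cases ρ with
    | nil => exact absurd rfl hne
    | cons a ρ => exact ⟨a, by simp, by rw [h, hend]; exact hrun.1⟩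

theorem labelFrom_snoc (pre : List ℕ) (S : Set E) (τ : List ℕ) (k : ℕ) :
    G.labelFrom F ord pre S (τ ++ [k]) =
      (G.labelFrom F ord pre S τ).bind
        fun S' => (ord.enum (pre ++ τ) (G.childLoops F S'))[k]? := by
  induction τ generalizing pre S with
  | nil =>
    simp only [List.nil_append, labelFrom, List.append_nil, Option.bind_some]
    cases (ord.enum pre (G.childLoops F S))[k]? <;> rfl
  | cons a τ ih =>
    simp only [List.cons_append, labelFrom]
    cases (ord.enum pre (G.childLoops F S))[a]? with
    | none => rfl
    | some S' => simp only [Option.bind_some, ih]; simp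

theorem acdLabel_snoc (i : ℕ) (τ : List ℕ) (k : ℕ) (l : Set E)
    (h : G.acdLabel F ord i (τ ++ [k]) = some l) :
    ∃ S, G.acdLabel F ord i τ = some S ∧ l ∈ G.childLoops F S := by
  cases i with
  | zero => cases τ <;> simp [acdLabel] at h
  | succ i =>
    simp only [acdLabel] at h ⊢
    cases hr : (ord.enum [] {l | G.IsMaxLoop l})[i]? with
    | none => simp [hr] at h
    | some R =>
      rw [hr] at h
      simp only [Option.bind_some, labelFrom_snoc] at h ⊢
      cases hS : G.labelFrom F ord [i] R τ with
      | none => simp [hS] at h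
      | some S =>
        rw [hS] at h
        exact ⟨S, rfl, (ord.mem_enum _ _ _).1 (List.mem_of_getElem? h)⟩

theorem isLoop_of_acdLabel (i : ℕ) (τ : List ℕ) (l : Set E)
    (h : G.acdLabel F ord (i + 1) τ = some l) : G.IsLoop l := by
  rcases List.eq_nil_or_concat τ with rfl | ⟨τ, k, rfl⟩
  · simp only [acdLabel, labelFrom] at h
    rw [show (fun l : Set E => some l) = some from rfl, Option.bind_fun_some] at h
    exact ((ord.mem_enum _ _ _).1 (List.mem_of_getElem? h)).1
  · rw [List.concat_eq_append] at h
    obtain ⟨S, _, hl⟩ := G.acdLabel_snoc F ord _ _ _ _ h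
    exact hl.1.2.1

theorem mem_nodeStates_stateIndex (q : V) :
    q ∈ G.nodeStates F ord (G.stateIndex F ord q) [] := by
  have hne : {i | q ∈ G.nodeStates F ord i []}.Nonempty := by
    by_cases h : q ∈ G.nodeStates F ord 0 []
    · exact ⟨0, h⟩
    · simp only [nodeStates, Set.mem_ofPred_eq, not_forall, not_not] at h
      obtain ⟨l, hl, hq⟩ := h
      obtain ⟨i, hi⟩ := List.getElem?_of_mem ((ord.mem_enum [] {l | G.IsMaxLoop l} l).2 hl)
      refine ⟨i + 1, ?_⟩
      simpa [nodeStates, acdNu, acdLabel, hi, labelFrom] using hq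
  exact Nat.sInf_mem hne

theorem root_mem_stateTree (q : V) : [] ∈ G.stateTree F ord q := by
  refine ⟨?_, G.mem_nodeStates_stateIndex F ord q⟩
  have h := G.mem_nodeStates_stateIndex F ord q
  cases hi : G.stateIndex F ord q with
  | zero => simp [acdTree, acdLabel]
  | succ i =>
    rw [hi] at h
    obtain ⟨e, he, _⟩ := h
    unfold acdNu at he
    unfold acdTree
    cases hl : G.acdLabel F ord (i + 1) [] with
    | none => simp [hl] at he
    | some l => simp [hl]

theorem stateTree_snoc (q : V) (τ : List ℕ) (k : ℕ) (h : τ ++ [k] ∈ G.stateTree F ord q) :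
    τ ∈ G.stateTree F ord q ∧
      G.acdNu F ord (G.stateIndex F ord q) (τ ++ [k]) ⊂
        G.acdNu F ord (G.stateIndex F ord q) τ := by
  obtain ⟨h1, h2⟩ := h
  obtain ⟨l, hl⟩ := Option.isSome_iff_exists.1 h1
  obtain ⟨S, hS, hlS⟩ := G.acdLabel_snoc F ord _ _ _ _ hl
  have hss : l ⊂ S := by
    refine lt_of_le_of_ne hlS.1.1 ?_
    rintro rfl
    exact iff_not_self hlS.1.2.2
  refine ⟨⟨by simp [acdTree, hS], ?_⟩, by simpa [acdNu, hl, hS] using hss⟩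
  cases hi : G.stateIndex F ord q with
  | zero => rw [hi] at h2; exact h2
  | succ i =>
    rw [hi] at h2 hl hS
    obtain ⟨e, he, heq⟩ := h2
    refine ⟨e, ?_, heq⟩
    simp only [acdNu, hl, hS, Option.getD_some] at he ⊢
    exact hss.1 he

theorem stateTree_of_prefix (q : V) {τ σ : List ℕ} (h : τ <+: σ)
    (hσ : σ ∈ G.stateTree F ord q) : τ ∈ G.stateTree F ord q := by
  obtain ⟨u, rfl⟩ := h
  induction u using List.reverseRecOn with
  | nil => simpa using hσ
  | append_singleton u k ih =>
    rw [← List.append_assoc] at hσ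
    exact ih (G.stateTree_snoc F ord q _ _ hσ).1

theorem exists_child (q : V) {τ : List ℕ} (hτ : τ ∈ G.stateTree F ord q)
    (h : ¬ IsLeaf (G.stateTree F ord q) τ) : ∃ k, τ ++ [k] ∈ G.stateTree F ord q := by
  simp only [IsLeaf, not_and, not_forall] at h
  obtain ⟨σ, hσ, ⟨u, rfl⟩, hne⟩ := h hτ
  cases u with
  | nil => simp at hne
  | cons k u => exact ⟨k, G.stateTree_of_prefix F ord q ⟨u, by simp⟩ hσ⟩

theorem exists_isLeftmost [Finite E] (q : V) (τ : List ℕ) (hτ : τ ∈ G.stateTree F ord q) :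
    ∃ β, IsLeftmost (G.stateTree F ord q) τ β := by
  induction hn : (G.acdNu F ord (G.stateIndex F ord q) τ).ncard using Nat.strong_induction_on
    generalizing τ with
  | _ n ih =>
    by_cases hleaf : IsLeaf (G.stateTree F ord q) τ
    · exact ⟨τ, ⟨hleaf, List.prefix_rfl⟩, fun β' hβ' h => (hleaf.2 β' hβ'.1 h).ge⟩
    · have hex := G.exists_child F ord q hτ hleaf
      have hk := Nat.sInf_mem (s := {k | τ ++ [k] ∈ G.stateTree F ord q}) hex
      set k := sInf {k | τ ++ [k] ∈ G.stateTree F ord q} with hkdef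
      have hlt := Set.ncard_lt_ncard (G.stateTree_snoc F ord q _ _ hk).2 (Set.toFinite _)
      obtain ⟨β, ⟨hβ, hpre⟩, hmin⟩ := ih _ (hn ▸ hlt) (τ ++ [k]) hk rfl
      refine ⟨β, ⟨hβ, (List.prefix_append τ [k]).trans hpre⟩, fun β' hβ' hτβ' => ?_⟩
      obtain ⟨u, rfl⟩ := hτβ'
      cases u with
      | nil =>
        have := hβ'.2 (τ ++ [k]) hk (by simp)
        simp at this
      | cons m u =>
        have hm : τ ++ [m] ∈ G.stateTree F ord q :=
          G.stateTree_of_prefix F ord q ⟨u, by simp⟩ hβ'.1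
        rcases (Nat.sInf_le (s := {k | τ ++ [k] ∈ G.stateTree F ord q}) hm).eq_or_lt with h | h
        · refine hmin _ hβ' ⟨u, ?_⟩
          rw [hkdef, h]; simp
        · obtain ⟨w, rfl⟩ := hpre
          apply le_of_lt
          rw [List.append_assoc]
          exact List.append_left_lt (List.Lex.rel h)

theorem leftmost_spec [Finite E] (q : V) (τ : List ℕ) (hτ : τ ∈ G.stateTree F ord q) :
    IsLeftmost (G.stateTree F ord q) τ (leftmost (G.stateTree F ord q) τ) := by
  have h := G.exists_isLeftmost F ord q τ hτ
  rw [leftmost, dif_pos h]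
  exact h.choose_spec

theorem nextChild_mem (q : V) (β τ : List ℕ) (hτ : τ ∈ G.stateTree F ord q) :
    G.nextChild F ord q β τ ∈ G.stateTree F ord q := by
  unfold nextChild
  split_ifs with h1 h2
  · exact hτ
  · obtain ⟨m, hm, k, hk, hkt⟩ := h2
    exact (Nat.sInf_mem (s := {k | (∃ m, β[τ.length]? = some m ∧ m < k) ∧
      τ ++ [k] ∈ G.stateTree F ord q}) ⟨k, ⟨m, hm, hk⟩, hkt⟩).2
  · exact Nat.sInf_mem (s := {k | τ ++ [k] ∈ G.stateTree F ord q})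
      (G.exists_child F ord q hτ h1)

theorem supp_mem (x : G.ACDState F ord) (e : E) :
    G.supp F ord x.branch x.index e ∈ G.stateTree F ord (G.target e) := by
  classical
  unfold supp
  split_ifs with h
  · set n := Nat.findGreatest (fun n => e ∈ G.acdNu F ord x.index (x.branch.take n))
      x.branch.length with hn
    rcases Nat.eq_zero_or_pos n with h0 | hpos
    · rw [h0, List.take_zero]; exact G.root_mem_stateTree F ord _
    · have he : e ∈ G.acdNu F ord x.index (x.branch.take n) :=
        Nat.findGreatest_of_ne_zero (P := fun n => e ∈ G.acdNu F ord x.index (x.branch.take n))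
          hn.symm hpos.ne'
      cases hl : G.acdLabel F ord x.index (x.branch.take n) with
      | none => simp [acdNu, hl] at he
      | some l =>
        refine ⟨by rw [← h]; simp [acdTree, hl], ?_⟩
        rw [← h]
        have hi : x.index ≠ 0 := by
          intro hi
          rw [hi] at hl
          have hle : n ≤ x.branch.length := Nat.findGreatest_le _
          cases hb : x.branch with
          | nil => rw [hb] at hle; simp at hle; omega
          | cons a b =>
            obtain ⟨n', hn'⟩ := Nat.exists_eq_succ_of_ne_zero hpos.ne'
            rw [hb, hn'] at hl
            simp [acdLabel] at hl
        obtain ⟨i, hi⟩ := Nat.exists_eq_succ_of_ne_zero hi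
        rw [hi] at he hl ⊢
        simp only [acdNu, hl, Option.getD_some, nodeStates] at he ⊢
        exact G.target_mem_loopStates (G.isLoop_of_acdLabel F ord i _ l hl) he
  · exact G.root_mem_stateTree F ord _

theorem nextBranch_isLeaf [Finite E] (x : G.ACDState F ord) (e : E) :
    IsLeaf (G.stateTree F ord (G.target e))
      (G.nextBranch F ord (G.target e) x.branch x.index
        (G.supp F ord x.branch x.index e)) := by
  have hs := G.supp_mem F ord x e
  unfold nextBranch
  split_ifs
  · exact (G.leftmost_spec F ord _ _ (G.nextChild_mem F ord _ _ _ hs)).1.1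
  · exact (G.leftmost_spec F ord _ _ hs).1.1

/-- The parity transition system obtained by the ACD-transformation of the graph `G` with the
Muller condition `F` over the set of edges, for the given order of siblings. -/
noncomputable def acdSystem [Finite E] :
    TransitionSystem (G.ACDState F ord) (G.ACDEdge F ord) ℕ where
  source x := x.origin
  target x :=
    { state := G.target x.edge
      index := G.stateIndex F ord (G.target x.edge)
      branch := G.nextBranch F ord (G.target x.edge) x.origin.branch x.origin.index
        (G.supp F ord x.origin.branch x.origin.index x.edge)
      index_eq := rfl
      isLeaf := G.nextBranch_isLeaf F ord x.origin x.edge }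
  init := {x | x.state ∈ G.init ∧ x.branch = leftmost (G.stateTree F ord x.state) []}
  init_nonempty := by
    obtain ⟨q, hq⟩ := G.init_nonempty
    exact ⟨⟨q, _, leftmost (G.stateTree F ord q) [], rfl,
      (G.leftmost_spec F ord q _ (G.root_mem_stateTree F ord q)).1.1⟩, hq, rfl⟩
  out_nonempty x := by
    obtain ⟨e, he⟩ := G.out_nonempty x.state
    exact ⟨⟨e, x, he⟩, rfl⟩
  color x := G.nodePriority F ord (G.stateIndex F ord (G.target x.edge))
    (G.supp F ord x.origin.branch x.origin.index x.edge)
  acc := parityAcc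

end TSGraph

namespace TransitionSystem

variable {V E C : Type*}

/-- A Muller condition `F` over the colours, rewritten as a Muller condition over the edges.
If the colours are the edges themselves (`T.color = id`), this is `F`. -/
def edgeFamily (T : TransitionSystem V E C) (F : Set (Set C)) : Set (Set E) :=
  {A | T.color '' A ∈ F}

/-- The ACD-parity transition system of a transition system with the Muller condition `F`. -/
noncomputable def acdParity [Finite E] (T : TransitionSystem V E C) (F : Set (Set C))
    (ord : SiblingOrder E) :
    TransitionSystem (T.ACDState (T.edgeFamily F) ord) (T.ACDEdge (T.edgeFamily F) ord) ℕ :=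
  T.toTSGraph.acdSystem (T.edgeFamily F) ord

end TransitionSystem

/-!
The projection of the transformed system is locally bijective by construction: an edge of the
transformed system is an edge of the original one together with a state over its source, and over
each initial vertex there is exactly one initial state, given by the leftmost branch. Runs, finite
or infinite, therefore lift uniquely, and everything except the acceptance of runs follows from
this: words, resolvers and strategies are transported along the bijection between the runs. Since
winning regions involve plays from arbitrary vertices, acceptance is compared for all infinite
runs of the transformed system, not only for those from initial vertices.

Let `L` be the set of edges that the projection of a run takes infinitely often. It is a loop, so
from some point on the run stays among the states of one proper tree, of index `i`. The branches
`β` and `β'` before and after an edge with support `τ` both pass through `τ`. Hence, if `m` is the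
least depth of a support that occurs infinitely often, the part of the branches up to depth `m`
becomes constant; it is a node `τ`, the dominating node (`exists_isDominating`). All later
supports lie below `τ`, which makes the priority of `τ` the least one that occurs infinitely
often (`isLeast_infSet_color`), and `L` is contained in the label of `τ`.

If exactly one of `L` and the label of `τ` belonged to `F`, then `L` would be contained in the
label of some child of `τ`. All states visited from some point on would belong to that child. Each
time the support is `τ`, the branch moves on to the next child of `τ`, cyclically, so it would
arrive at the child that contains `L` and never leave it, and `τ` would not be a support any more
(`not_infSet_subset_child`). So `L ∈ F` if and only if the label of `τ` is in `F`, and as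
membership in `F` alternates along the branches of the tree, this is what the parity of the
priority of `τ` says (`even_nodePriority_iff`).
-/

/-! ### Runs and their prefixes -/

namespace TSGraph

variable {V E : Type*} (G : TSGraph V E)

theorem isFinRunFrom_append (v : V) (ρ σ : List E) :
    G.IsFinRunFrom v (ρ ++ σ) ↔ G.IsFinRunFrom v ρ ∧ G.IsFinRunFrom (G.endpoint v ρ) σ := by
  induction ρ generalizing v with
  | nil => simp [IsFinRunFrom, endpoint]
  | cons e ρ ih => simp [IsFinRunFrom, endpoint, ih, and_assoc]

theorem endpoint_append (v : V) (ρ σ : List E) :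
    G.endpoint v (ρ ++ σ) = G.endpoint (G.endpoint v ρ) σ := by
  induction ρ generalizing v with
  | nil => rfl
  | cons e ρ ih => simp [endpoint, ih]

variable {G}

theorem IsInfRunFrom.finRun_prefix {v : V} {ρ : ℕ → E} (h : G.IsInfRunFrom v ρ) (n : ℕ) :
    G.IsFinRunFrom v ((List.range n).map ρ) ∧
      G.endpoint v ((List.range n).map ρ) = G.source (ρ n) := by
  induction n with
  | zero => exact ⟨trivial, h.1.symm⟩
  | succ n ih =>
    rw [List.range_succ, List.map_append, isFinRunFrom_append, endpoint_append, ih.2]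
    exact ⟨⟨ih.1, rfl, trivial⟩, h.2 n⟩

theorem IsInfRunFrom.shift {v : V} {ρ : ℕ → E} (h : G.IsInfRunFrom v ρ) (N : ℕ) :
    G.IsInfRunFrom (G.source (ρ N)) (fun n => ρ (N + n)) :=
  ⟨rfl, fun n => h.2 (N + n)⟩

/-! ### Lifting of runs -/

/-- The sequence of edges from `v` whose edges are chosen by `lift`, which selects for a vertex
`v` and an element `e'` an edge that leaves `v`. -/
def liftRun {E' : Type*} (G : TSGraph V E) (lift : V → E' → E) : V → List E' → List E
  | _, [] => []
  | v, e :: ρ => lift v e :: liftRun G lift (G.target (lift v e)) ρ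

/-- The infinite version of `liftRun`. -/
def liftInfRun {E' : Type*} (G : TSGraph V E) (lift : V → E' → E) (v : V) (ρ : ℕ → E') (n : ℕ) :
    E :=
  lift (G.endpoint v (G.liftRun lift v ((List.range n).map ρ))) (ρ n)

variable {E' : Type*} {lift : V → E' → E}

theorem liftRun_append_singleton (v : V) (ρ : List E') (e : E') :
    G.liftRun lift v (ρ ++ [e]) =
      G.liftRun lift v ρ ++ [lift (G.endpoint v (G.liftRun lift v ρ)) e] := by
  induction ρ generalizing v with
  | nil => rfl
  | cons a ρ ih => simp [liftRun, endpoint, ih]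

theorem map_range_liftInfRun (v : V) (ρ : ℕ → E') (n : ℕ) :
    (List.range n).map (G.liftInfRun lift v ρ) = G.liftRun lift v ((List.range n).map ρ) := by
  induction n with
  | zero => rfl
  | succ n ih =>
    rw [List.range_succ, List.map_append, List.map_append, ih, List.map_singleton,
      List.map_singleton, liftRun_append_singleton]
    rfl

theorem isFinRunFrom_liftRun (hs : ∀ v e, G.source (lift v e) = v) (v : V) (ρ : List E') :
    G.IsFinRunFrom v (G.liftRun lift v ρ) := by
  induction ρ generalizing v with
  | nil => trivial
  | cons a ρ ih => exact ⟨hs v a, ih _⟩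

theorem isInfRunFrom_liftInfRun (hs : ∀ v e, G.source (lift v e) = v) (v : V) (ρ : ℕ → E') :
    G.IsInfRunFrom v (G.liftInfRun lift v ρ) := by
  refine ⟨hs _ _, fun n => ?_⟩
  conv_rhs => rw [liftInfRun, hs, List.range_succ, List.map_append, List.map_singleton,
    liftRun_append_singleton, endpoint_append]
  rfl

end TSGraph

section Morphisms

variable {V E C V' E' C' : Type*} {T : TransitionSystem V E C} {T' : TransitionSystem V' E' C'}
  {fV : V → V'} {fE : E → E'}

namespace IsTSMorphism

theorem map_isFinRunFrom (h : IsTSMorphism T T' fV fE) {v : V} {ρ : List E}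
    (hρ : T.IsFinRunFrom v ρ) : T'.IsFinRunFrom (fV v) (ρ.map fE) := by
  induction ρ generalizing v with
  | nil => trivial
  | cons e ρ ih =>
    refine ⟨by rw [h.map_source, hρ.1], ?_⟩
    rw [h.map_target]
    exact ih hρ.2

theorem endpoint_map (h : IsTSMorphism T T' fV fE) (v : V) (ρ : List E) :
    T'.endpoint (fV v) (ρ.map fE) = fV (T.endpoint v ρ) := by
  induction ρ generalizing v with
  | nil => rfl
  | cons e ρ ih => simp only [List.map_cons, TSGraph.endpoint, h.map_target, ih]

theorem map_isInfRunFrom (h : IsTSMorphism T T' fV fE) {v : V} {ρ : ℕ → E}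
    (hρ : T.IsInfRunFrom v ρ) : T'.IsInfRunFrom (fV v) (fun n => fE (ρ n)) :=
  ⟨by rw [h.map_source, hρ.1], fun n => by rw [h.map_source, h.map_target, hρ.2]⟩

theorem mapsTo_infRuns (h : IsTSMorphism T T' fV fE) :
    Set.MapsTo (fun ρ n => fE (ρ n)) T.infRuns T'.infRuns :=
  fun _ ⟨v, hv, hρ⟩ => ⟨fV v, h.map_init v hv, h.map_isInfRunFrom hρ⟩

end IsTSMorphism

namespace IsTSLocallyInjective

theorem isFinRunFrom_ext (h : IsTSLocallyInjective T T' fV fE) {v : V} {ρ σ : List E}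
    (hρ : T.IsFinRunFrom v ρ) (hσ : T.IsFinRunFrom v σ) (he : ρ.map fE = σ.map fE) : ρ = σ := by
  induction ρ generalizing v σ with
  | nil => simpa [eq_comm] using he
  | cons a ρ ih =>
    cases σ with
    | nil => simp at he
    | cons b σ =>
      rw [List.map_cons, List.map_cons, List.cons.injEq] at he
      obtain rfl := h.inj_out a b (hρ.1.trans hσ.1.symm) he.1
      rw [ih hρ.2 hσ.2 he.2]

theorem isInfRunFrom_ext (h : IsTSLocallyInjective T T' fV fE) {v : V} {ρ σ : ℕ → E}
    (hρ : T.IsInfRunFrom v ρ) (hσ : T.IsInfRunFrom v σ) (he : ∀ n, fE (ρ n) = fE (σ n)) :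
    ρ = σ := by
  funext n
  induction n with
  | zero => exact h.inj_out _ _ (hρ.1.trans hσ.1.symm) (he 0)
  | succ n ih => exact h.inj_out _ _ (by rw [← hρ.2, ← hσ.2, ih]) (he _)

theorem injOn_finRuns (h : IsTSLocallyInjective T T' fV fE) :
    Set.InjOn (List.map fE) T.finRuns := by
  rintro ρ ⟨v, hv, hρ⟩ σ ⟨w, hw, hσ⟩ he
  cases ρ with
  | nil => simpa [eq_comm] using he
  | cons a ρ =>
    cases σ with
    | nil => simp at he
    | cons b σ =>
      have hab : fE a = fE b := (List.cons.inj he).1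
      obtain rfl : v = w := h.inj_init v hv w hw (by
        rw [← hρ.1, ← hσ.1, ← h.map_source, ← h.map_source, hab])
      exact h.isFinRunFrom_ext hρ hσ he

theorem injOn_infRuns (h : IsTSLocallyInjective T T' fV fE) :
    Set.InjOn (fun (ρ : ℕ → E) n => fE (ρ n)) T.infRuns := by
  rintro ρ ⟨v, hv, hρ⟩ σ ⟨w, hw, hσ⟩ he
  have he : ∀ n, fE (ρ n) = fE (σ n) := congrFun he
  obtain rfl : v = w := h.inj_init v hv w hw (by
    rw [← hρ.1, ← hσ.1, ← h.map_source, ← h.map_source, he])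
  exact h.isInfRunFrom_ext hρ hσ he

end IsTSLocallyInjective

namespace IsTSLocallySurjective

/-- A choice of lifts of edges. It is total: when `e'` does not leave the image of `v`, an
arbitrary edge that leaves `v` is chosen, so that every lifted sequence is a run. -/
theorem exists_lift (h : IsTSLocallySurjective T T' fV fE) :
    ∃ lift : V → E' → E, (∀ v e', T.source (lift v e') = v) ∧
      ∀ v e', T'.source e' = fV v → fE (lift v e') = e' := by
  have : ∀ v e', ∃ e, T.source e = v ∧ (T'.source e' = fV v → fE e = e') := by
    intro v e'
    by_cases he : T'.source e' = fV v
    · obtain ⟨e, h1, h2⟩ := h.surj_out v e' he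
      exact ⟨e, h2, fun _ => h1⟩
    · obtain ⟨e, h1⟩ := T.out_nonempty v
      exact ⟨e, h1, fun h2 => absurd h2 he⟩
  choose lift hs hl using this
  exact ⟨lift, hs, hl⟩

theorem map_liftRun (h : IsTSLocallySurjective T T' fV fE) {lift : V → E' → E}
    (hl : ∀ v e', T'.source e' = fV v → fE (lift v e') = e') {v : V} {ρ : List E'}
    (hρ : T'.IsFinRunFrom (fV v) ρ) : (T.liftRun lift v ρ).map fE = ρ := by
  induction ρ generalizing v with
  | nil => rfl
  | cons a ρ ih =>
    have ha := hl v a hρ.1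
    rw [TSGraph.liftRun, List.map_cons, ha, ih]
    rw [← h.map_target, ha]
    exact hρ.2

theorem map_liftInfRun (h : IsTSLocallySurjective T T' fV fE) {lift : V → E' → E}
    (hl : ∀ v e', T'.source e' = fV v → fE (lift v e') = e') {v : V} {ρ : ℕ → E'}
    (hρ : T'.IsInfRunFrom (fV v) ρ) (n : ℕ) : fE (T.liftInfRun lift v ρ n) = ρ n := by
  obtain ⟨h1, h2⟩ := hρ.finRun_prefix n
  refine hl _ _ ?_
  rw [← h2, ← h.endpoint_map, h.map_liftRun hl h1]

theorem exists_infRun (h : IsTSLocallySurjective T T' fV fE) {v : V} {ρ : ℕ → E'}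
    (hρ : T'.IsInfRunFrom (fV v) ρ) : ∃ σ, T.IsInfRunFrom v σ ∧ (fun n => fE (σ n)) = ρ := by
  obtain ⟨lift, hs, hl⟩ := h.exists_lift
  exact ⟨_, TSGraph.isInfRunFrom_liftInfRun hs v ρ, funext (h.map_liftInfRun hl hρ)⟩

end IsTSLocallySurjective

namespace IsTSLocallyBijective

theorem bijOn_finRuns (h : IsTSLocallyBijective T T' fV fE) :
    Set.BijOn (List.map fE) T.finRuns T'.finRuns := by
  refine ⟨fun ρ ⟨v, hv, hρ⟩ => ⟨fV v, h.1.map_init v hv, h.1.map_isFinRunFrom hρ⟩,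
    h.2.injOn_finRuns, ?_⟩
  rintro ρ ⟨v', hv', hρ⟩
  obtain ⟨v, hv, rfl⟩ := h.1.surj_init v' hv'
  obtain ⟨lift, hs, hl⟩ := h.1.exists_lift
  exact ⟨_, ⟨v, hv, TSGraph.isFinRunFrom_liftRun hs v ρ⟩, h.1.map_liftRun hl hρ⟩

theorem bijOn_infRuns (h : IsTSLocallyBijective T T' fV fE) :
    Set.BijOn (fun ρ n => fE (ρ n)) T.infRuns T'.infRuns := by
  refine ⟨h.1.mapsTo_infRuns, h.2.injOn_infRuns, ?_⟩
  rintro ρ ⟨v', hv', hρ⟩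
  obtain ⟨v, hv, rfl⟩ := h.1.surj_init v' hv'
  obtain ⟨σ, hσ, hm⟩ := h.1.exists_infRun hρ
  exact ⟨σ, ⟨v, hv, hσ⟩, hm⟩

/-! ### Automata and locally bijective morphisms -/

variable {A : Type*} (letter : E' → A)

theorem language_eq (h : IsTSLocallyBijective T T' fV fE) :
    T.language (fun e => letter (fE e)) = T'.language letter := by
  ext u
  constructor
  · rintro ⟨ρ, ⟨hρ, hu⟩, hacc⟩
    exact ⟨_, ⟨h.1.mapsTo_infRuns hρ, hu⟩, (h.1.map_acc ρ hρ).1 hacc⟩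
  · rintro ⟨ρ, ⟨hρ, hu⟩, hacc⟩
    obtain ⟨σ, hσ, rfl⟩ := h.bijOn_infRuns.surjOn hρ
    exact ⟨σ, ⟨hσ, hu⟩, (h.1.map_acc σ hσ).2 hacc⟩

theorem init_eq_singleton (h : IsTSLocallyBijective T T' fV fE) {v' : V'}
    (hv' : T'.init = {v'}) : ∃ v, T.init = {v} ∧ fV v = v' := by
  obtain ⟨v, hv, rfl⟩ := h.1.surj_init v' (by rw [hv']; rfl)
  refine ⟨v, Set.eq_singleton_iff_unique_mem.2 ⟨hv, fun w hw => h.2.inj_init w hw v hv ?_⟩, rfl⟩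
  have := h.1.map_init w hw
  rwa [hv'] at this

theorem isDeterministic_iff (h : IsTSLocallyBijective T T' fV fE)
    (hsurj : Function.Surjective fV) :
    T'.IsDeterministic letter ↔ T.IsDeterministic (fun e => letter (fE e)) := by
  constructor
  · rintro ⟨⟨v', hv'⟩, hdet⟩
    obtain ⟨v, hv, -⟩ := h.init_eq_singleton hv'
    refine ⟨⟨v, hv⟩, fun w a => ?_⟩
    obtain ⟨e', ⟨hs, ha⟩, huniq⟩ := hdet (fV w) a
    obtain ⟨e, rfl, he⟩ := h.1.surj_out w e' hs
    refine ⟨e, ⟨he, ha⟩, fun d ⟨hd, hda⟩ => h.2.inj_out d e (hd.trans he.symm) ?_⟩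
    exact huniq _ ⟨by rw [h.1.map_source, hd], hda⟩
  · rintro ⟨⟨v, hv⟩, hdet⟩
    refine ⟨⟨fV v, Set.eq_singleton_iff_unique_mem.2
      ⟨h.1.map_init v (by rw [hv]; rfl), fun w' hw' => ?_⟩⟩, fun w' a => ?_⟩
    · obtain ⟨w, hw, rfl⟩ := h.1.surj_init w' hw'
      rw [hv] at hw
      rw [hw]
    · obtain ⟨w, rfl⟩ := hsurj w'
      obtain ⟨e, ⟨hs, ha⟩, huniq⟩ := hdet w a
      refine ⟨fE e, ⟨by rw [h.1.map_source, hs], ha⟩, fun d' ⟨hd, hda⟩ => ?_⟩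
      obtain ⟨d, rfl, hd'⟩ := h.1.surj_out w d' hd
      rw [huniq d ⟨hd', hda⟩]

theorem isUnambiguous_iff (h : IsTSLocallyBijective T T' fV fE) :
    T'.IsUnambiguous letter ↔ T.IsUnambiguous (fun e => letter (fE e)) := by
  constructor
  · intro hun u ρ σ hρ hρa hσ hσa
    exact h.2.injOn_infRuns hρ.1 hσ.1 (hun u _ _ ⟨h.1.mapsTo_infRuns hρ.1, hρ.2⟩
      ((h.1.map_acc ρ hρ.1).1 hρa) ⟨h.1.mapsTo_infRuns hσ.1, hσ.2⟩
      ((h.1.map_acc σ hσ.1).1 hσa))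
  · intro hun u ρ' σ' hρ hρa hσ hσa
    obtain ⟨ρ, hρi, rfl⟩ := h.bijOn_infRuns.surjOn hρ.1
    obtain ⟨σ, hσi, rfl⟩ := h.bijOn_infRuns.surjOn hσ.1
    rw [hun u ρ σ ⟨hρi, hρ.2⟩ ((h.1.map_acc ρ hρi).2 hρa) ⟨hσi, hσ.2⟩
      ((h.1.map_acc σ hσi).2 hσa)]

/-- A resolver is projected edge by edge; conversely, a resolver of `T'` is lifted along the run
that it has built so far, which is determined by the word read so far. -/
theorem isGoodForGames_iff (h : IsTSLocallyBijective T T' fV fE) :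
    T'.IsGoodForGames letter ↔ T.IsGoodForGames (fun e => letter (fE e)) := by
  constructor
  · rintro ⟨q', hq', σ, hσ⟩
    obtain ⟨q, hq, rfl⟩ := h.1.surj_init q' hq'
    obtain ⟨lift, hs, hl⟩ := h.1.exists_lift
    refine ⟨q, hq, fun w => lift (T.endpoint q (T.liftRun lift q
      ((List.range (w.length - 1)).map fun i => σ (w.take (i + 1))))) (σ w), fun u hu => ?_⟩
    rw [h.language_eq] at hu
    obtain ⟨h1, h2, h3⟩ := hσ u hu
    set ρ : ℕ → E' := fun n => σ ((List.range (n + 1)).map u)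
    have hlift : (fun n => lift (T.endpoint q (T.liftRun lift q
        ((List.range (((List.range (n + 1)).map u).length - 1)).map
          fun i => σ (((List.range (n + 1)).map u).take (i + 1)))))
        (σ ((List.range (n + 1)).map u))) = T.liftInfRun lift q ρ := by
      funext n
      have : (List.range (((List.range (n + 1)).map u).length - 1)).map
          (fun i => σ (((List.range (n + 1)).map u).take (i + 1))) = (List.range n).map ρ := by
        rw [List.length_map, List.length_range, Nat.add_sub_cancel]
        refine List.map_congr_left fun i hi => ?_
        rw [← List.map_take, List.take_range, min_eq_left (by have := List.mem_range.1 hi; omega)]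
      rw [this]
      rfl
    have hrun := TSGraph.isInfRunFrom_liftInfRun (G := T.toTSGraph) hs q ρ
    have hmap := h.1.map_liftInfRun hl h1
    rw [hlift]
    refine ⟨hrun, fun n => ?_, (h.1.map_acc _ ⟨q, hq, hrun⟩).2 ?_⟩
    · dsimp only
      rw [hmap, h2]
    · rwa [funext hmap]
  · rintro ⟨q, hq, σ, hσ⟩
    refine ⟨fV q, h.1.map_init q hq, fun w => fE (σ w), fun u hu => ?_⟩
    rw [← h.language_eq] at hu
    obtain ⟨h1, h2, h3⟩ := hσ u hu
    exact ⟨h.1.map_isInfRunFrom h1, h2, (h.1.map_acc _ ⟨q, hq, h1⟩).1 h3⟩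

/-! ### Games and locally bijective morphisms -/

/-- A locally bijective morphism that preserves acceptance of all infinite runs, also of those
that do not start in an initial vertex, preserves the winner of the game from every vertex:
strategies are lifted and projected along the bijection between the plays from `v` and the plays
from its image. -/
theorem winsFrom_iff (h : IsTSLocallyBijective T T' fV fE)
    (hacc : ∀ v ρ, T.IsInfRunFrom v ρ → (T.Accepts ρ ↔ T'.Accepts (fun n => fE (ρ n))))
    (owner : V' → Player) (v : V) (p : Player) :
    T'.WinsFrom owner (fV v) p ↔ T.WinsFrom (fun w => owner (fV w)) v p := by
  have hwin : ∀ ρ, T.IsInfRunFrom v ρ →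
      (T.WinsPlay ρ p ↔ T'.WinsPlay (fun n => fE (ρ n)) p) := by
    intro ρ hρ
    cases p
    · exact hacc v ρ hρ
    · exact not_congr (hacc v ρ hρ)
  obtain ⟨lift, hs, hl⟩ := h.1.exists_lift
  constructor
  · rintro ⟨S, hS, hS'⟩
    refine ⟨fun ρ => lift (T.endpoint v ρ) (S (ρ.map fE)), fun ρ _ _ => hs _ _,
      fun ρ hρ hcons => (hwin ρ hρ).2 (hS' _ (h.1.map_isInfRunFrom hρ) fun n hn => ?_)⟩
    rw [h.1.map_source] at hn
    obtain ⟨hf, hend⟩ := hρ.finRun_prefix n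
    have hsrc : T'.source (S (((List.range n).map ρ).map fE)) = fV (T.source (ρ n)) := by
      rw [hS _ (h.1.map_isFinRunFrom hf), h.1.endpoint_map, hend]
      rw [h.1.endpoint_map, hend, hn]
    have := hcons n hn
    dsimp only at this
    rw [this, hend, hl _ _ hsrc, List.map_map]
    rfl
  · rintro ⟨S, hS, hS'⟩
    have hstep : ∀ ρ, T'.IsFinRunFrom (fV v) ρ →
        fV (T.endpoint v (T.liftRun lift v ρ)) = T'.endpoint (fV v) ρ := by
      intro ρ hρ
      rw [← h.1.endpoint_map, h.1.map_liftRun hl hρ]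
    refine ⟨fun ρ => fE (S (T.liftRun lift v ρ)), fun ρ hρ hown => ?_, fun ρ hρ hcons => ?_⟩
    · rw [h.1.map_source, hS _ (TSGraph.isFinRunFrom_liftRun hs v ρ), hstep ρ hρ]
      simpa only [hstep ρ hρ] using hown
    · have hrun := TSGraph.isInfRunFrom_liftInfRun (G := T.toTSGraph) hs v ρ
      have hmap := h.1.map_liftInfRun hl hρ
      have := (hwin _ hrun).1 (hS' _ hrun fun n hn => ?_)
      · rwa [funext hmap] at this
      · obtain ⟨hf, hend⟩ := hrun.finRun_prefix n
        have hn' := hn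
        dsimp only at hn'
        rw [← h.1.map_source, hmap] at hn'
        refine h.2.inj_out _ _ ?_ ?_
        · rw [hS _ hf, hend]
          rwa [hend]
        · rw [hmap, hcons n hn', TSGraph.map_range_liftInfRun]

end IsTSLocallyBijective

end Morphisms

/-! ### Letters that occur infinitely often -/

theorem exists_eq_of_mem_infSet {A : Type*} {w : ℕ → A} {a : A} (ha : a ∈ infSet w) (N : ℕ) :
    ∃ n, N ≤ n ∧ w n = a := by
  obtain ⟨n, hn, hlt⟩ := Set.Infinite.exists_gt ha N
  exact ⟨n, hlt.le, hn⟩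

theorem exists_forall_mem_infSet {A : Type*} [Finite A] (w : ℕ → A) :
    ∃ N, ∀ n, N ≤ n → w n ∈ infSet w := by
  have hfin : (⋃ a ∈ (infSet w)ᶜ, {n | w n = a}).Finite :=
    (Set.toFinite _).biUnion fun a ha => Set.not_infinite.1 ha
  obtain ⟨N, hN⟩ := hfin.bddAbove
  refine ⟨N + 1, fun n hn => by_contra fun h => ?_⟩
  have := hN (Set.mem_biUnion (show w n ∈ (infSet w)ᶜ from h) rfl)
  omega

theorem infSet_comp {A B : Type*} [Finite A] (f : A → B) (w : ℕ → A) :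
    infSet (fun n => f (w n)) = f '' infSet w := by
  ext b
  constructor
  · intro hb
    obtain ⟨N, hN⟩ := exists_forall_mem_infSet w
    obtain ⟨n, hn, rfl⟩ := exists_eq_of_mem_infSet hb N
    exact ⟨w n, hN n hn, rfl⟩
  · rintro ⟨a, ha, rfl⟩
    exact Set.Infinite.mono (fun n (hn : w n = a) => by simp [hn]) ha

/-- A sequence of natural numbers that does not increase from some point on cannot decrease
infinitely often. -/
theorem false_of_frequently_lt {f : ℕ → ℕ} {N : ℕ} (hle : ∀ n, N ≤ n → f (n + 1) ≤ f n)
    (hlt : ∀ n, ∃ n', n ≤ n' ∧ f (n' + 1) < f n') : False := by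
  have key : ∀ v n, N ≤ n → f n = v → False := by
    intro v
    induction v using Nat.strong_induction_on with
    | _ v ih =>
      rintro n hn rfl
      have hanti : ∀ n', n ≤ n' → f n' ≤ f n := by
        intro n' hn'
        induction n', hn' using Nat.le_induction with
        | base => exact le_rfl
        | succ n' h1 ih' => exact (hle n' (hn.trans h1)).trans ih'
      obtain ⟨n', h1, h2⟩ := hlt n
      exact ih _ (h2.trans_le (hanti n' h1)) (n' + 1) (by omega) rfl
  exact key _ N le_rfl rfl

namespace TSGraph

variable {V E : Type*} {G : TSGraph V E}

/-! ### Loops -/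

theorem IsLoop.exists_closed_run {l : Set E} (hl : G.IsLoop l) {v : V}
    (hv : v ∈ G.loopStates l) :
    ∃ ρ, ρ ≠ [] ∧ G.IsFinRunFrom v ρ ∧ G.endpoint v ρ = v ∧ {e | e ∈ ρ} = l := by
  obtain ⟨w, ρ, -, hrun, hend, rfl⟩ := hl
  obtain ⟨e, he, rfl⟩ := hv
  obtain ⟨a, b, rfl⟩ := List.append_of_mem (show e ∈ ρ from he)
  rw [isFinRunFrom_append] at hrun
  rw [endpoint_append] at hend
  have hsrc : G.source e = G.endpoint w a := hrun.2.1
  refine ⟨(e :: b) ++ a, by simp, ?_, ?_, ?_⟩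
  · rw [isFinRunFrom_append, hsrc, hend]
    exact ⟨hrun.2, hrun.1⟩
  · rw [endpoint_append, hsrc, hend]
  · ext x
    simp only [List.cons_append, List.mem_cons, List.mem_append, Set.mem_ofPred_eq]
    tauto

theorem IsLoop.union {l m : Set E} (hl : G.IsLoop l) (hm : G.IsLoop m) {v : V}
    (hvl : v ∈ G.loopStates l) (hvm : v ∈ G.loopStates m) : G.IsLoop (l ∪ m) := by
  obtain ⟨ρ, hne, hρ, hρv, rfl⟩ := hl.exists_closed_run hvl
  obtain ⟨σ, -, hσ, hσv, rfl⟩ := hm.exists_closed_run hvm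
  refine ⟨v, ρ ++ σ, by simp [hne], ?_, ?_, ?_⟩
  · rw [isFinRunFrom_append, hρv]
    exact ⟨hρ, hσ⟩
  · rw [endpoint_append, hρv, hσv]
  · ext x
    simp

theorem IsMaxLoop.eq_of_mem_loopStates {l m : Set E} (hl : G.IsMaxLoop l) (hm : G.IsMaxLoop m)
    {v : V} (hvl : v ∈ G.loopStates l) (hvm : v ∈ G.loopStates m) : l = m := by
  have hu := hl.1.union hm.1 hvl hvm
  rw [← hl.eq_of_ge hu Set.subset_union_left]
  exact hm.eq_of_ge hu Set.subset_union_right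

/-- The edges that a run takes infinitely often form a loop: they are the edges of a long enough
segment that returns to its first vertex. -/
theorem IsInfRunFrom.isLoop_infSet [Finite E] {v : V} {ρ : ℕ → E} (h : G.IsInfRunFrom v ρ) :
    G.IsLoop (infSet ρ) := by
  obtain ⟨N, hN⟩ := exists_forall_mem_infSet ρ
  choose f hf hfρ using fun a : infSet ρ => exists_eq_of_mem_infSet a.2 N
  obtain ⟨M, hM⟩ := (Set.finite_range f).bddAbove
  obtain ⟨K, hK, hKN⟩ := exists_eq_of_mem_infSet (hN N le_rfl) (N + M + 1)
  obtain ⟨h1, h2⟩ := (h.shift N).finRun_prefix (K - N)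
  refine ⟨_, _, ?_, h1, ?_, ?_⟩
  · rw [Ne, List.map_eq_nil_iff, List.range_eq_nil]
    omega
  · rw [h2, Nat.add_sub_cancel' (by omega), hKN]
  · ext a
    simp only [List.mem_map, List.mem_range, Set.mem_ofPred_eq]
    constructor
    · rintro ⟨n, -, rfl⟩
      exact hN _ (by omega)
    · intro ha
      have h3 := hf ⟨a, ha⟩
      have h4 := hM (Set.mem_range_self ⟨a, ha⟩)
      refine ⟨f ⟨a, ha⟩ - N, by omega, ?_⟩
      rw [Nat.add_sub_cancel' h3, hfρ]

/-! ### The trees of the alternating cycle decomposition -/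

variable {F : Set (Set E)} {ord : SiblingOrder E}

theorem acdLabel_succ_nil (i : ℕ) :
    G.acdLabel F ord (i + 1) [] = (ord.enum [] {l | G.IsMaxLoop l})[i]? := by
  simp only [acdLabel, labelFrom]
  cases (ord.enum [] {l | G.IsMaxLoop l})[i]? <;> rfl

theorem acdLabel_succ_snoc (i : ℕ) (τ : List ℕ) (k : ℕ) :
    G.acdLabel F ord (i + 1) (τ ++ [k]) = (G.acdLabel F ord (i + 1) τ).bind
      fun S => (ord.enum ([i] ++ τ) (G.childLoops F S))[k]? := by
  simp only [acdLabel, labelFrom_snoc]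
  cases (ord.enum [] {l | G.IsMaxLoop l})[i]? <;> rfl

theorem mem_acdTree_of_mem_acdNu {i : ℕ} {τ : List ℕ} {e : E} (he : e ∈ G.acdNu F ord i τ) :
    τ ∈ G.acdTree F ord i := by
  unfold acdNu at he
  unfold acdTree
  cases hl : G.acdLabel F ord i τ with
  | none => simp [hl] at he
  | some l => simp [hl]

theorem acdLabel_eq_some {i : ℕ} {τ : List ℕ} (h : τ ∈ G.acdTree F ord i) :
    G.acdLabel F ord i τ = some (G.acdNu F ord i τ) := by
  obtain ⟨l, hl⟩ := Option.isSome_iff_exists.1 h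
  simp [acdNu, hl]

theorem acdNu_snoc {i : ℕ} {τ : List ℕ} {k : ℕ} (h : τ ++ [k] ∈ G.acdTree F ord i) :
    τ ∈ G.acdTree F ord i ∧
      G.acdNu F ord i (τ ++ [k]) ∈ G.childLoops F (G.acdNu F ord i τ) := by
  obtain ⟨S, hS, hl⟩ := G.acdLabel_snoc F ord _ _ _ _ (acdLabel_eq_some h)
  have hτ : τ ∈ G.acdTree F ord i := by simp [acdTree, hS]
  rw [acdLabel_eq_some hτ, Option.some_inj] at hS
  exact ⟨hτ, hS ▸ hl⟩

theorem acdNu_subset_of_prefix {i : ℕ} {τ σ : List ℕ} (h : τ <+: σ) :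
    G.acdNu F ord i σ ⊆ G.acdNu F ord i τ := by
  obtain ⟨u, rfl⟩ := h
  induction u using List.reverseRecOn with
  | nil => simp
  | append_singleton u k ih =>
    rw [← List.append_assoc]
    intro e he
    exact ih ((acdNu_snoc (mem_acdTree_of_mem_acdNu he)).2.1.1 he)

theorem exists_acdNu_snoc {i : ℕ} {τ : List ℕ} (hτ : τ ∈ G.acdTree F ord (i + 1)) {l : Set E}
    (hl : l ∈ G.childLoops F (G.acdNu F ord (i + 1) τ)) :
    ∃ k, τ ++ [k] ∈ G.acdTree F ord (i + 1) ∧ G.acdNu F ord (i + 1) (τ ++ [k]) = l := by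
  obtain ⟨k, hk⟩ := List.getElem?_of_mem ((ord.mem_enum ([i] ++ τ) _ _).2 hl)
  have : G.acdLabel F ord (i + 1) (τ ++ [k]) = some l := by
    rw [acdLabel_succ_snoc, acdLabel_eq_some hτ, Option.bind_some, hk]
  exact ⟨k, by simp [acdTree, this], by simp [acdNu, this]⟩

/-- Membership in `F` alternates along the branches of the trees. -/
theorem acdNu_mem_iff {i : ℕ} {τ : List ℕ} (h : τ ∈ G.acdTree F ord i) :
    G.acdNu F ord i τ ∈ F ↔ (G.acdNu F ord i [] ∈ F ↔ Even τ.length) := by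
  induction τ using List.reverseRecOn with
  | nil => simp
  | append_singleton τ k ih =>
    obtain ⟨hτ, hc⟩ := acdNu_snoc h
    rw [hc.1.2.2, ih hτ, List.length_append, List.length_singleton, Nat.even_add_one]
    tauto

theorem even_nodePriority_iff {i : ℕ} (hi : i ≠ 0) {τ : List ℕ} (h : τ ∈ G.acdTree F ord i) :
    Even (G.nodePriority F ord i τ) ↔ G.acdNu F ord i τ ∈ F := by
  rw [acdNu_mem_iff h, nodePriority, if_neg hi]
  split_ifs with h1 h2
  · simp [h1, Nat.even_add]
  · simp [h1]
  · simp [h1, Nat.even_add_one]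

theorem nodePriority_mono {i : ℕ} (hi : i ≠ 0) {τ σ : List ℕ} (h : τ.length ≤ σ.length) :
    G.nodePriority F ord i τ ≤ G.nodePriority F ord i σ := by
  simp only [nodePriority, if_neg hi]
  split_ifs <;> omega

/-- Distinct maximal loops have no state in common, so the index of a state is unique. -/
theorem stateIndex_eq {i : ℕ} {q : V} (hq : q ∈ G.nodeStates F ord (i + 1) []) :
    G.stateIndex F ord q = i + 1 := by
  have hex : ∀ i, q ∈ G.nodeStates F ord (i + 1) [] →
      ∃ l, (ord.enum [] {l | G.IsMaxLoop l})[i]? = some l ∧ G.IsMaxLoop l ∧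
        q ∈ G.loopStates l := by
    rintro i hqi
    obtain ⟨e, he, -⟩ := id hqi
    have hl := acdLabel_eq_some (mem_acdTree_of_mem_acdNu he)
    rw [acdLabel_succ_nil] at hl
    exact ⟨_, hl, (ord.mem_enum _ _ _).1 (List.mem_of_getElem? hl), hqi⟩
  obtain ⟨l, hl, hlmax, hql⟩ := hex i hq
  have hmem := G.mem_nodeStates_stateIndex F ord q
  cases hj : G.stateIndex F ord q with
  | zero => exact absurd hql ((hj ▸ hmem : q ∈ G.nodeStates F ord 0 []) l hlmax)
  | succ j =>
    obtain ⟨m, hm, hmmax, hqm⟩ := hex j (hj ▸ hmem)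
    obtain rfl := hlmax.eq_of_mem_loopStates hmmax hql hqm
    have hlt : j < (ord.enum [] {l | G.IsMaxLoop l}).length := (List.getElem?_eq_some_iff.1 hm).1
    rw [(List.getElem?_inj hlt (ord.nodup _ _)).1 (hm.trans hl.symm)]

/-- Every loop is contained in the root label of a proper tree. -/
theorem IsLoop.exists_subset_root [Finite E] {l : Set E} (hl : G.IsLoop l) :
    ∃ i, l ⊆ G.acdNu F ord (i + 1) [] := by
  obtain ⟨m, hlm, hm⟩ := (Set.toFinite {l | G.IsLoop l}).exists_le_maximal hl
  obtain ⟨i, hi⟩ := List.getElem?_of_mem ((ord.mem_enum [] {l | G.IsMaxLoop l} m).2 hm)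
  refine ⟨i, ?_⟩
  rw [← acdLabel_succ_nil (F := F)] at hi
  simpa [acdNu, hi] using hlm

/-! ### Finiteness -/

theorem length_add_ncard_le [Finite E] {q : V} {τ : List ℕ} (h : τ ∈ G.stateTree F ord q) :
    τ.length + (G.acdNu F ord (G.stateIndex F ord q) τ).ncard ≤ Nat.card E := by
  induction τ using List.reverseRecOn with
  | nil => simpa using Set.ncard_le_card _
  | append_singleton τ k ih =>
    obtain ⟨hτ, hlt⟩ := G.stateTree_snoc F ord q _ _ h
    have := Set.ncard_lt_ncard hlt (Set.toFinite _)
    have := ih hτ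
    rw [List.length_append, List.length_singleton]
    omega

theorem lt_of_mem_of_mem_acdTree [Finite E] {i : ℕ} {τ : List ℕ} (h : τ ∈ G.acdTree F ord i) :
    ∀ k ∈ τ, k < Nat.card (Set E) := by
  cases i with
  | zero => cases τ <;> simp [acdTree, acdLabel] at h ⊢
  | succ i =>
    induction τ using List.reverseRecOn with
    | nil => simp
    | append_singleton τ k ih =>
      intro m hm
      rcases List.mem_append.1 hm with hm | hm
      · exact ih (acdNu_snoc h).1 m hm
      · obtain rfl := List.mem_singleton.1 hm
        have hl := acdLabel_eq_some h
        rw [acdLabel_succ_snoc, acdLabel_eq_some (acdNu_snoc h).1, Option.bind_some] at hl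
        have := Fintype.ofFinite (Set E)
        rw [Nat.card_eq_fintype_card]
        exact (List.getElem?_eq_some_iff.1 hl).1.trans_le (ord.nodup _ _).length_le_card

variable (G F ord)

theorem finite_acdState [Finite E] : Finite (G.ACDState F ord) := by
  have hV : Finite V := Finite.of_surjective G.source G.out_nonempty
  have hfin := (List.finite_length_le (Fin (Nat.card (Set E))) (Nat.card E)).image
    (List.map Fin.val)
  have := hfin.to_subtype
  have hmem : ∀ x : G.ACDState F ord, x.branch ∈ List.map Fin.val ''
      {l : List (Fin (Nat.card (Set E))) | l.length ≤ Nat.card E} := by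
    intro x
    have hr : x.branch ∈ Set.range (List.map (Fin.val (n := Nat.card (Set E)))) := by
      rw [Set.range_list_map]
      intro k hk
      exact ⟨⟨k, lt_of_mem_of_mem_acdTree x.isLeaf.1.1 k hk⟩, rfl⟩
    obtain ⟨l, hl⟩ := hr
    have := length_add_ncard_le x.isLeaf.1
    rw [← hl, List.length_map] at this
    exact ⟨l, le_of_add_le_left this, hl⟩
  refine Finite.of_injective
    (fun x : G.ACDState F ord => (x.state, (⟨x.branch, hmem x⟩ : Subtype _))) fun x y h => ?_
  rw [Prod.mk.injEq, Subtype.mk.injEq] at h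
  exact ACDState.ext h.1 (by rw [x.index_eq, y.index_eq, h.1]) h.2

theorem finite_acdEdge [Finite E] : Finite (G.ACDEdge F ord) := by
  have := G.finite_acdState F ord
  refine Finite.of_injective (fun x : G.ACDEdge F ord => (x.edge, x.origin)) fun x y h => ?_
  rw [Prod.mk.injEq] at h
  exact ACDEdge.ext h.1 h.2

theorem exists_acdState [Finite E] (q : V) : ∃ x : G.ACDState F ord,
    x.state = q ∧ x.branch = leftmost (G.stateTree F ord x.state) [] :=
  ⟨⟨q, _, leftmost (G.stateTree F ord q) [], rfl,
    (G.leftmost_spec F ord q _ (G.root_mem_stateTree F ord q)).1.1⟩, rfl, rfl⟩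

end TSGraph

namespace TSGraph

variable {V E : Type*} {G : TSGraph V E} {F : Set (Set E)} {ord : SiblingOrder E}

/-! ### Supports and next branches -/

theorem supp_prefix (β : List ℕ) (i : ℕ) (e : E) : G.supp F ord β i e <+: β := by
  unfold supp
  split_ifs
  · exact List.take_prefix _ _
  · exact List.nil_prefix

theorem mem_acdNu_supp {β : List ℕ} {i : ℕ} {e : E} (hi : G.stateIndex F ord (G.target e) = i)
    (he : e ∈ G.acdNu F ord i []) : e ∈ G.acdNu F ord i (G.supp F ord β i e) := by
  classical
  rw [supp, if_pos hi.symm]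
  exact Nat.findGreatest_spec (P := fun n => e ∈ G.acdNu F ord i (β.take n)) (Nat.zero_le _)
    (by simpa using he)

theorem prefix_supp {β τ : List ℕ} {i : ℕ} {e : E} (hi : G.stateIndex F ord (G.target e) = i)
    (hτ : τ <+: β) (he : e ∈ G.acdNu F ord i τ) : τ <+: G.supp F ord β i e := by
  classical
  refine List.prefix_of_prefix_length_le hτ (supp_prefix β i e) ?_
  rw [supp, if_pos hi.symm, List.length_take]
  refine le_min (Nat.le_findGreatest hτ.length_le ?_) hτ.length_le
  rwa [← List.prefix_iff_eq_take.1 hτ]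

theorem prefix_nextChild (q : V) (β τ : List ℕ) : τ <+: G.nextChild F ord q β τ := by
  unfold nextChild
  split_ifs
  · exact List.prefix_rfl
  · exact List.prefix_append _ _
  · exact List.prefix_append _ _

/-- Taking the next child of `τ` cyclically never jumps over a child `τ ++ [k]` of `τ` in `t_q`:
from a child `c` to the left of `k` one moves to the right, but not beyond `k`; from a child to
the right of `k` one moves to the right, or starts again at a child not beyond `k`. -/
theorem nextChild_spec {q : V} {β τ : List ℕ} {k c : ℕ} (hk : τ ++ [k] ∈ G.stateTree F ord q)
    (hc : β[τ.length]? = some c) (hck : c ≠ k) :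
    ∃ c', G.nextChild F ord q β τ = τ ++ [c'] ∧
      ((c < c' ∧ (c < k → c' ≤ k)) ∨ (k < c ∧ c' ≤ k)) := by
  have hleaf : ¬ IsLeaf (G.stateTree F ord q) τ := fun h => by
    have := h.2 _ hk (List.prefix_append _ _)
    simp at this
  rw [nextChild, if_neg hleaf]
  split_ifs with h
  · refine ⟨_, rfl, Or.inl ⟨?_, fun hlt => Nat.sInf_le ⟨⟨c, hc, hlt⟩, hk⟩⟩⟩
    obtain ⟨m, hm, k', hk', hmem⟩ := h
    obtain ⟨⟨m', hm', hlt⟩, -⟩ := Nat.sInf_mem (s := {k | (∃ m, β[τ.length]? = some m ∧ m < k) ∧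
      τ ++ [k] ∈ G.stateTree F ord q}) ⟨k', ⟨m, hm, hk'⟩, hmem⟩
    rw [hc, Option.some_inj] at hm'
    exact hm' ▸ hlt
  · refine ⟨_, rfl, Or.inr ⟨?_, Nat.sInf_le hk⟩⟩
    exact hck.lt_or_gt.resolve_left fun hlt => h ⟨c, hc, k, hlt, hk⟩

/-- The support of an edge of the transformed system: the node which determines its priority. -/
noncomputable def ACDEdge.support (a : G.ACDEdge F ord) : List ℕ :=
  G.supp F ord a.origin.branch a.origin.index a.edge

theorem nextChild_prefix_target_branch [Finite E] {a : G.ACDEdge F ord}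
    (hi : G.stateIndex F ord (G.target a.edge) = a.origin.index) :
    G.nextChild F ord (G.target a.edge) a.origin.branch a.support <+:
      ((G.acdSystem F ord).target a).branch := by
  change _ <+: G.nextBranch F ord (G.target a.edge) a.origin.branch a.origin.index a.support
  rw [nextBranch, if_pos hi.symm]
  exact (G.leftmost_spec F ord _ _
    (G.nextChild_mem F ord _ _ _ (G.supp_mem F ord a.origin a.edge))).1.2

/-! ### The dominating node of a run -/

theorem isInfRunFrom_edge [Finite E] {x : G.ACDState F ord} {ρ : ℕ → G.ACDEdge F ord}
    (h : (G.acdSystem F ord).IsInfRunFrom x ρ) :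
    G.IsInfRunFrom x.state (fun n => (ρ n).edge) := by
  refine ⟨by rw [(ρ 0).source_eq, ← h.1]; rfl, fun n => ?_⟩
  rw [(ρ (n + 1)).source_eq]
  exact congrArg ACDState.state (h.2 n)

/-- `τ` is the dominating node of the run `ρ` in the proper tree of index `i`, and `N` is a
position from which on this is visible: from there on `ρ` only takes edges that occur infinitely
often and stays among the states of index `i`, and all supports lie below `τ`; moreover `τ` is the
support of an edge that is taken infinitely often. -/
structure IsDominating (ρ : ℕ → G.ACDEdge F ord) (i : ℕ) (τ : List ℕ) (N : ℕ) : Prop where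
  mem_infSet : ∀ n, N ≤ n → ρ n ∈ infSet ρ
  index_origin : ∀ n, N ≤ n → (ρ n).origin.index = i + 1
  index_target : ∀ n, N ≤ n → G.stateIndex F ord (G.target (ρ n).edge) = i + 1
  mem_root : ∀ n, N ≤ n → (ρ n).edge ∈ G.acdNu F ord (i + 1) []
  prefix_support : ∀ n, N ≤ n → τ <+: (ρ n).support
  exists_support_eq : ∃ a ∈ infSet ρ, a.support = τ

/-- Every run has a dominating node, namely a support of minimal depth among those that occur
infinitely often: the part of the branch up to this depth does not change any more, so it is a
prefix of all later supports. -/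
theorem exists_isDominating [Finite E] {x : G.ACDState F ord} {ρ : ℕ → G.ACDEdge F ord}
    (h : (G.acdSystem F ord).IsInfRunFrom x ρ) : ∃ i τ N, IsDominating ρ i τ N := by
  have := G.finite_acdEdge F ord
  obtain ⟨N, hN⟩ := exists_forall_mem_infSet ρ
  have hrun := isInfRunFrom_edge h
  obtain ⟨i, hi⟩ := hrun.isLoop_infSet.exists_subset_root (F := F) (ord := ord)
  have hroot : ∀ n, N ≤ n → (ρ n).edge ∈ G.acdNu F ord (i + 1) [] := by
    intro n hn
    refine hi ?_
    rw [infSet_comp (fun a : G.ACDEdge F ord => a.edge) ρ]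
    exact ⟨_, hN n hn, rfl⟩
  have hsrc : ∀ n, N ≤ n → G.stateIndex F ord (G.source (ρ n).edge) = i + 1 :=
    fun n hn => stateIndex_eq ⟨_, hroot n hn, rfl⟩
  have hidx : ∀ n, N ≤ n → (ρ n).origin.index = i + 1 := by
    intro n hn
    rw [(ρ n).origin.index_eq, ← (ρ n).source_eq, hsrc n hn]
  have htgt : ∀ n, N ≤ n → G.stateIndex F ord (G.target (ρ n).edge) = i + 1 := by
    intro n hn
    rw [hrun.2 n, hsrc (n + 1) (by omega)]
  obtain ⟨a, ha, hmin⟩ := (Set.toFinite (infSet ρ)).exists_minimalFor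
    (fun a : G.ACDEdge F ord => a.support.length) _ ⟨_, hN N le_rfl⟩
  have hle : ∀ n, N ≤ n → a.support.length ≤ (ρ n).support.length := by
    intro n hn
    by_contra! hlt
    exact absurd (hmin (hN n hn) hlt.le) (not_le.2 hlt)
  have hstep : ∀ n, N ≤ n → (ρ n).support <+: (ρ (n + 1)).origin.branch := by
    intro n hn
    have h1 := nextChild_prefix_target_branch (a := ρ n) (by rw [htgt n hn, hidx n hn])
    rw [h.2 n] at h1
    exact (prefix_nextChild _ _ _).trans h1
  obtain ⟨n₀, hn₀, hρ₀⟩ := exists_eq_of_mem_infSet ha N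
  have hpre : ∀ n, n₀ ≤ n → a.support <+: (ρ n).support := by
    have hbr : ∀ n, N ≤ n → a.support <+: (ρ n).origin.branch → a.support <+: (ρ n).support :=
      fun n hn hb => List.prefix_of_prefix_length_le hb (supp_prefix _ _ _) (hle n hn)
    intro n hn
    induction n, hn using Nat.le_induction with
    | base => rw [hρ₀]
    | succ n hn ih =>
      exact hbr (n + 1) (by omega) (ih.trans (hstep n (hn₀.trans hn)))
  exact ⟨i, a.support, n₀,
    { mem_infSet := fun n hn => hN n (hn₀.trans hn)
      index_origin := fun n hn => hidx n (hn₀.trans hn)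
      index_target := fun n hn => htgt n (hn₀.trans hn)
      mem_root := fun n hn => hroot n (hn₀.trans hn)
      prefix_support := hpre
      exists_support_eq := ⟨a, ha, rfl⟩ }⟩

namespace IsDominating

variable {ρ : ℕ → G.ACDEdge F ord} {i : ℕ} {τ : List ℕ} {N : ℕ}

theorem mem_acdNu_support (h : IsDominating ρ i τ N) {n : ℕ} (hn : N ≤ n) :
    (ρ n).edge ∈ G.acdNu F ord (i + 1) (ρ n).support := by
  unfold ACDEdge.support
  rw [h.index_origin n hn]
  exact mem_acdNu_supp (h.index_target n hn) (h.mem_root n hn)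

theorem infSet_subset (h : IsDominating ρ i τ N) :
    infSet (fun n => (ρ n).edge) ⊆ G.acdNu F ord (i + 1) τ := by
  intro e he
  obtain ⟨n, hn, rfl⟩ := exists_eq_of_mem_infSet he N
  exact acdNu_subset_of_prefix (h.prefix_support n hn) (h.mem_acdNu_support hn)

theorem edge_mem_infSet [Finite E] (h : IsDominating ρ i τ N) {n : ℕ} (hn : N ≤ n) :
    (ρ n).edge ∈ infSet (fun n => (ρ n).edge) := by
  have := G.finite_acdEdge F ord
  rw [infSet_comp (fun a : G.ACDEdge F ord => a.edge) ρ]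
  exact ⟨_, h.mem_infSet n hn, rfl⟩

theorem mem_acdTree [Finite E] (h : IsDominating ρ i τ N) : τ ∈ G.acdTree F ord (i + 1) :=
  mem_acdTree_of_mem_acdNu (h.infSet_subset (h.edge_mem_infSet le_rfl))

/-- The loop of the edges taken infinitely often is contained in no child of the dominating node
`τ`: otherwise that child would belong to all trees `t_q` of the states `q` visited from some
point on. Each time the support is `τ`, the branch moves to the next child of `τ`, cyclically;
hence it would reach that child, and then the support would never be `τ` again. -/
theorem not_infSet_subset_child [Finite E] {x : G.ACDState F ord} (h : IsDominating ρ i τ N)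
    (hrun : (G.acdSystem F ord).IsInfRunFrom x ρ) (k : ℕ) :
    ¬ infSet (fun n => (ρ n).edge) ⊆ G.acdNu F ord (i + 1) (τ ++ [k]) := by
  intro hsub
  have := G.finite_acdState F ord
  have hmem : ∀ n, N ≤ n → (ρ n).edge ∈ G.acdNu F ord (i + 1) (τ ++ [k]) :=
    fun n hn => hsub (h.edge_mem_infSet hn)
  have hrune := isInfRunFrom_edge hrun
  have htree : ∀ n, N ≤ n → τ ++ [k] ∈ G.stateTree F ord (ρ n).origin.state := by
    intro n hn
    have hidx := h.index_origin n hn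
    rw [(ρ n).origin.index_eq] at hidx
    rw [stateTree, Set.mem_ofPred_eq, hidx]
    exact ⟨mem_acdTree_of_mem_acdNu (hmem n hn), _, hmem n hn, (ρ n).source_eq⟩
  have hbranch : ∀ n, N ≤ n → τ <+: (ρ n).origin.branch :=
    fun n hn => (h.prefix_support n hn).trans (supp_prefix _ _ _)
  -- the child of `τ` on the branch exists, since `τ` is not a leaf of the tree of the state
  have hchild : ∀ n, ∃ c, N ≤ n → (ρ n).origin.branch[τ.length]? = some c := by
    intro n
    by_cases hn : N ≤ n
    · obtain ⟨u, hu⟩ := hbranch n hn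
      cases u with
      | nil =>
        rw [List.append_nil] at hu
        have := (ρ n).origin.isLeaf.2 _ (htree n hn) (hu ▸ List.prefix_append _ _)
        rw [← hu] at this
        simp at this
      | cons c u => exact ⟨c, fun _ => by rw [← hu]; simp⟩
    · exact ⟨0, fun h => absurd h hn⟩
  choose c hc using hchild
  have hcpre : ∀ n, N ≤ n → τ ++ [c n] <+: (ρ n).origin.branch := by
    intro n hn
    obtain ⟨u, hu⟩ := hbranch n hn
    have := hc n hn
    rw [← hu] at this ⊢
    cases u with
    | nil => simp at this
    | cons d u =>
      simp only [List.getElem?_append_right le_rfl, Nat.sub_self,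
        List.getElem?_cons_zero, Option.some_inj] at this
      rw [this]
      exact ⟨u, by simp⟩
  have hceq : ∀ n, N ≤ n → ∀ d, τ ++ [d] <+: (ρ n).origin.branch → c n = d := by
    rintro n hn d ⟨u, hu⟩
    have := hc n hn
    rw [← hu] at this
    simpa using this.symm
  -- an edge with support `τ` moves the branch to the next child of `τ`, other edges keep the child
  have hmove : ∀ n, N ≤ n → (ρ n).support = τ →
      c n ≠ k ∧ ((c n < c (n + 1) ∧ (c n < k → c (n + 1) ≤ k)) ∨
        (k < c n ∧ c (n + 1) ≤ k)) := by
    intro n hn hs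
    have hck : c n ≠ k := by
      intro hck
      have h1 := hcpre n hn
      rw [hck] at h1
      have h2 := prefix_supp (h.index_target n hn) h1 (hmem n hn)
      rw [← h.index_origin n hn] at h2
      change _ <+: (ρ n).support at h2
      rw [hs] at h2
      simpa using h2.length_le
    refine ⟨hck, ?_⟩
    have h1 := htree (n + 1) (by omega)
    rw [← (ρ (n + 1)).source_eq, ← hrune.2 n] at h1
    obtain ⟨c', hc', hc''⟩ := nextChild_spec h1 (hc n hn) hck
    have h2 := nextChild_prefix_target_branch (a := ρ n)
      (by rw [h.index_target n hn, h.index_origin n hn])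
    rw [hs, hc', hrun.2 n] at h2
    rwa [hceq (n + 1) (by omega) c' h2]
  have hkeep : ∀ n, N ≤ n → (ρ n).support ≠ τ → c (n + 1) = c n := by
    intro n hn hs
    refine hceq (n + 1) (by omega) _ ?_
    have h1 : τ ++ [c n] <+: (ρ n).support := by
      refine List.prefix_of_prefix_length_le (hcpre n hn) (supp_prefix _ _ _) ?_
      rw [List.length_append, List.length_singleton]
      obtain ⟨u, hu⟩ := h.prefix_support n hn
      rw [← hu] at hs ⊢
      cases u with
      | nil => simp at hs
      | cons d u => simp
    have h2 := nextChild_prefix_target_branch (a := ρ n)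
      (by rw [h.index_target n hn, h.index_origin n hn])
    rw [hrun.2 n] at h2
    exact (h1.trans (prefix_nextChild _ _ _)).trans h2
  obtain ⟨B, hB⟩ := (Set.finite_range
    fun y : G.ACDState F ord => (y.branch[τ.length]?).getD 0).bddAbove
  have hcB : ∀ n, N ≤ n → c n ≤ B := by
    intro n hn
    have := hB (Set.mem_range_self (ρ n).origin)
    simpa only [hc n hn, Option.getD_some] using this
  -- the cyclic distance to the child `k` decreases whenever the support is `τ`
  set d : ℕ → ℕ := fun n => if c n ≤ k then k - c n else B + k + 1 - c n with hd
  have hlt : ∀ n, N ≤ n → (ρ n).support = τ → d (n + 1) < d n := by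
    intro n hn hs
    obtain ⟨h1, h2⟩ := hmove n hn hs
    have h3 := hcB n hn
    have h4 := hcB (n + 1) (by omega)
    simp only [hd]
    split_ifs <;> omega
  refine false_of_frequently_lt (f := d) (N := N) (fun n hn => ?_) fun n => ?_
  · by_cases hs : (ρ n).support = τ
    · exact (hlt n hn hs).le
    · simp only [hd, hkeep n hn hs, le_refl]
  · obtain ⟨a, ha, has⟩ := h.exists_support_eq
    obtain ⟨n', hn', rfl⟩ := exists_eq_of_mem_infSet ha (max N n)
    exact ⟨n', (le_max_right _ _).trans hn', hlt n' ((le_max_left _ _).trans hn') has⟩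

theorem infSet_mem_iff [Finite E] {x : G.ACDState F ord} (h : IsDominating ρ i τ N)
    (hrun : (G.acdSystem F ord).IsInfRunFrom x ρ) :
    infSet (fun n => (ρ n).edge) ∈ F ↔ G.acdNu F ord (i + 1) τ ∈ F := by
  by_contra hne
  obtain ⟨l, hle, hl⟩ := (Set.toFinite {l | l ⊆ G.acdNu F ord (i + 1) τ ∧ G.IsLoop l ∧
    (l ∈ F ↔ G.acdNu F ord (i + 1) τ ∉ F)}).exists_le_maximal
      ⟨h.infSet_subset, (isInfRunFrom_edge hrun).isLoop_infSet, by tauto⟩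
  obtain ⟨k, -, rfl⟩ := exists_acdNu_snoc h.mem_acdTree hl
  exact h.not_infSet_subset_child hrun k hle

theorem isLeast_infSet_color [Finite E] (h : IsDominating ρ i τ N) :
    IsLeast (infSet fun n => (G.acdSystem F ord).color (ρ n))
      (G.nodePriority F ord (i + 1) τ) := by
  have := G.finite_acdEdge F ord
  have hcol : ∀ a ∈ infSet ρ, (G.acdSystem F ord).color a =
      G.nodePriority F ord (i + 1) a.support ∧ τ <+: a.support := by
    intro a ha
    obtain ⟨n, hn, rfl⟩ := exists_eq_of_mem_infSet ha N
    refine ⟨?_, h.prefix_support n hn⟩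
    rw [← h.index_target n hn]
    rfl
  rw [infSet_comp (G.acdSystem F ord).color ρ]
  constructor
  · obtain ⟨a, ha, has⟩ := h.exists_support_eq
    exact ⟨a, ha, by rw [(hcol a ha).1, has]⟩
  · rintro _ ⟨a, ha, rfl⟩
    rw [(hcol a ha).1]
    exact nodePriority_mono i.succ_ne_zero (hcol a ha).2.length_le

end IsDominating

/-- The transformed system accepts a run, from any vertex, exactly when its projection satisfies
the Muller condition. -/
theorem acdSystem_accepts_iff [Finite E] {x : G.ACDState F ord} {ρ : ℕ → G.ACDEdge F ord}
    (hrun : (G.acdSystem F ord).IsInfRunFrom x ρ) :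
    (G.acdSystem F ord).Accepts ρ ↔ infSet (fun n => (ρ n).edge) ∈ F := by
  obtain ⟨i, τ, N, h⟩ := exists_isDominating hrun
  rw [h.infSet_mem_iff hrun, ← even_nodePriority_iff i.succ_ne_zero h.mem_acdTree]
  constructor
  · rintro ⟨m, hm, heven⟩
    rwa [h.isLeast_infSet_color.unique hm]
  · exact fun heven => ⟨_, h.isLeast_infSet_color, heven⟩

end TSGraph

/-! ### The projection of the transformed system -/

namespace TransitionSystem

variable {V E C : Type*} [Finite E] {T : TransitionSystem V E C} {F : Set (Set C)}

theorem acdParity_accepts_iff (hT : T.IsMuller F) (ord : SiblingOrder E)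
    {x : T.ACDState (T.edgeFamily F) ord} {ρ : ℕ → T.ACDEdge (T.edgeFamily F) ord}
    (hρ : (T.acdParity F ord).IsInfRunFrom x ρ) :
    (T.acdParity F ord).Accepts ρ ↔ T.Accepts (fun n => (ρ n).edge) := by
  have hacc : T.Accepts (fun n => (ρ n).edge) ↔ infSet (fun n => T.color (ρ n).edge) ∈ F := by
    rw [Accepts, hT]
    rfl
  rw [hacc, infSet_comp T.color (fun n => (ρ n).edge)]
  exact TSGraph.acdSystem_accepts_iff hρ

theorem acdParity_isTSLocallyBijective (hT : T.IsMuller F) (ord : SiblingOrder E) :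
    IsTSLocallyBijective (T.acdParity F ord) T (fun x => x.state) (fun x => x.edge) := by
  have hmor : IsTSMorphism (T.acdParity F ord) T (fun x => x.state) (fun x => x.edge) :=
    { map_init := fun x hx => hx.1
      map_source := fun e => e.source_eq
      map_target := fun e => rfl
      map_acc := fun ρ ⟨x, _, hρ⟩ => acdParity_accepts_iff hT ord hρ }
  refine ⟨{ hmor with surj_init := fun q hq => ?_, surj_out := fun x e he => ?_ },
    { hmor with inj_init := fun x hx y hy hxy => ?_, inj_out := fun a b hs he => ?_ }⟩
  · obtain ⟨x, rfl, hx⟩ := T.exists_acdState (T.edgeFamily F) ord q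
    exact ⟨x, ⟨hq, hx⟩, rfl⟩
  · exact ⟨⟨e, x, he⟩, rfl, rfl⟩
  · exact TSGraph.ACDState.ext hxy (by rw [x.index_eq, y.index_eq, hxy])
      (by rw [hx.2, hy.2, hxy])
  · exact TSGraph.ACDEdge.ext he hs

end TransitionSystem

theorem mainTheorem3 {V E C LV LE A : Type*} [Finite E]
    (T : TransitionSystem V E C) (F : Set (Set C)) (hT : T.IsMuller F)
    (ord : SiblingOrder E) :
    let P := T.acdParity F ord
    let φV : T.ACDState (T.edgeFamily F) ord → V := fun x => x.state
    let φE : T.ACDEdge (T.edgeFamily F) ord → E := fun x => x.edge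
    -- the transformed system is a finite parity transition system
    (Finite (T.ACDState (T.edgeFamily F) ord) ∧ Finite (T.ACDEdge (T.edgeFamily F) ord) ∧
      P.IsParity) ∧
    -- the projection is a locally bijective morphism
    IsTSLocallyBijective P T φV φE ∧
    -- it induces bijections between the runs, and preserves their acceptance
    (Set.BijOn (List.map φE) P.finRuns T.finRuns ∧
      Set.BijOn (fun ρ n => φE (ρ n)) P.infRuns T.infRuns ∧
      ∀ ρ ∈ P.infRuns, (P.Accepts ρ ↔ T.Accepts (fun n => φE (ρ n)))) ∧
    -- it is a morphism of labelled transition systems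
    (∀ (lV : V → LV) (lE : E → LE),
      IsLabelledMorphism P (fun x => lV x.state) (fun x => lE x.edge) T lV lE φV φE) ∧
    -- automata
    (∀ letter : E → A,
      P.language (fun x => letter x.edge) = T.language letter ∧
      (T.IsDeterministic letter ↔ P.IsDeterministic (fun x => letter x.edge)) ∧
      (T.IsUnambiguous letter ↔ P.IsUnambiguous (fun x => letter x.edge)) ∧
      (T.IsGoodForGames letter ↔ P.IsGoodForGames (fun x => letter x.edge))) ∧
    -- games
    (∀ (owner : V → Player) (v₀ : V), T.init = {v₀} →
      ∃ x₀, P.init = {x₀} ∧ ∀ p : Player,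
        (T.WinsFrom owner v₀ p ↔ P.WinsFrom (fun x => owner x.state) x₀ p) ∧
        T.winningRegion owner p = φV '' P.winningRegion (fun x => owner x.state) p) := by
  intro P φV φE
  have hbij : IsTSLocallyBijective P T φV φE := T.acdParity_isTSLocallyBijective hT ord
  have hacc : ∀ x ρ, P.IsInfRunFrom x ρ → (P.Accepts ρ ↔ T.Accepts (fun n => φE (ρ n))) :=
    fun _ _ hρ => TransitionSystem.acdParity_accepts_iff hT ord hρ
  have hsurj : Function.Surjective φV := fun q =>
    (T.exists_acdState (T.edgeFamily F) ord q).imp fun _ hx => hx.1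
  have hfinE := T.finite_acdEdge (T.edgeFamily F) ord
  refine ⟨⟨T.finite_acdState _ ord, hfinE, Set.finite_range _, rfl⟩, hbij,
    ⟨hbij.bijOn_finRuns, hbij.bijOn_infRuns, hbij.1.map_acc⟩,
    fun lV lE => ⟨hbij.1.toIsTSMorphism, fun _ => rfl, fun _ => rfl⟩,
    fun letter => ⟨hbij.language_eq letter, hbij.isDeterministic_iff letter hsurj,
      hbij.isUnambiguous_iff letter, hbij.isGoodForGames_iff letter⟩,
    fun owner v₀ hv₀ => ?_⟩
  obtain ⟨x₀, hx₀, rfl⟩ := hbij.init_eq_singleton hv₀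
  refine ⟨x₀, hx₀, fun p => ⟨hbij.winsFrom_iff hacc owner x₀ p, ?_⟩⟩
  ext v
  constructor
  · intro hv
    obtain ⟨x, rfl⟩ := hsurj v
    exact ⟨x, (hbij.winsFrom_iff hacc owner x p).1 hv, rfl⟩
  · rintro ⟨x, hx, rfl⟩
    exact (hbij.winsFrom_iff hacc owner x p).2 hx
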